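/- Let $K$ be a commutative ring. For a small category $\mathcal B$, a $\mathcal B$-module is a functor from $\mathcal B$ to $K$-modules. For a $\mathcal B^{op}$-module $M$ and a $\mathcal B$-module $N$, let $M\otimes_{\mathcal B}N$ be the quotient of $\bigoplus_{X}M(X)\otimes_K N(X)$ by the relations $M(\Phi)m\otimes n\sim m\otimes N(\Phi)n$ ($\Phi:X\to Y$, $m\in M(Y)$, $n\in N(X)$), and let $\mathrm{Tor}^{\mathcal B}_*(M,N)=H_*(M\otimes_{\mathcal B}q_*)$ for a projective resolution $q_*$ of $N$. All categories below have as objects the sets $[n]=\{0,\dots,n\}$, $n\ge 0$. A morphism of $\mathcal F(as)$ is a map of sets with a total order on each fibre; in a composite $g\circ f$ the fibre over $z$ is the concatenation of the fibres of $f$ over the elements of $g^{-1}(z)$, in the order of $g^{-1}(z)$. $\Gamma(as)\subset\mathcal F(as)$ is the subcategory of the morphisms with $0\mapsto 0$, and $\Sigma_\bullet\subset\Gamma(as)$ is the subcategory of the bijections fixing $0$. $\Delta$ is the simplicial category and $\Delta C$ is Connes' cyclic category; $\Delta C^{op}$ is a subcategory of $\mathcal F(as)$ through $d_i\mapsto\sigma_i$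 for $0\le i<n$, $d_n\mapsto\sigma_0\circ t$, $s_i\mapsto\delta_{i+1}$, with $t$ the permutation $j\mapsto j+1 \bmod (n+1)$, which is the image of the cyclic operator; this restricts to an inclusion of $\Delta^{op}$ in $\Gamma(as)$. $\mathcal O$ denotes the restriction of modules to a subcategory, and $K$ also denotes the trivial module (constant with value $K$) over $(\Delta^{op})^{op}$ or $(\Delta C^{op})^{op}$. A category $\mathcal B$ is crossed by two subcategories $\mathcal C,\mathcal D$ with the same objects, written $\mathcal B=\mathcal C\bowtie\mathcal D$, if each morphism $\Phi:X\to Z$ of $\mathcal B$ is $\Psi\circ f$ for a unique object $Y$, a unique $\Psi:Y\to Z$ in $\mathcal C$ and a unique $f:X\to Y$ in $\mathcal D$. In that case $\mathcal L_{\mathcal D}:\mathcal C^{op}\text{-Mod}\to\mathcal B^{op}\text{-Mod}$ is the functor $\mathcal L_{\mathcal D}(M)(X)=\bigoplus_{A}M(A)\otimes_K K[\mathrm{Hom}_{\mathcal D}(X,A)]$, where $(m\otimes g)\Phi=m\Psi'\otimes f'$ if $g\circ\Phi=\Psi'\circ f'$ is the factorization of $g\circ\Phi$. Functors $L:\mathcal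 C^{op}\text{-Mod}\to\mathcal B^{op}\text{-Mod}$ and $R:\mathcal B\text{-Mod}\to\mathcal C\text{-Mod}$ are pseudo-adjoint if there is an isomorphism $L(M)\otimes_{\mathcal B}N\cong M\otimes_{\mathcal C}R(N)$ natural in $M$ and $N$. Let $d_0,d_1:[1]\to[0]$ be the morphisms with the order $0<1$, respectively $1<0$, on the fibre. Let $b$ be the $\mathcal F(as)^{op}$-module that is the cokernel of $K[\mathrm{Hom}_{\mathcal F(as)}(-,[1])]\to K[\mathrm{Hom}_{\mathcal F(as)}(-,[0])]$, $\Phi\mapsto d_0\circ\Phi-d_1\circ\Phi$, and let $\bar b$ be the $\Gamma(as)^{op}$-module defined in the same way with $\Gamma(as)$ in place of $\mathcal F(as)$. **Theorem (Pirashvili–Richter).** One has $\Gamma(as)=\Delta^{op}\bowtie\Sigma_\bullet$ and $\mathcal F(as)=\Delta C^{op}\bowtie\Sigma_\bullet$; in both cases $\mathcal L_{\Sigma_\bullet}$ and $\mathcal O$ are pseudo-adjoint, and $\bar b\cong\mathcal L_{\Sigma_\bullet}(K)$ and $b\cong\mathcal L_{\Sigma_\bullet}(K)$, respectively. For every $\Gamma(as)$-module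 $M$ and every $\mathcal F(as)$-module $N$ there are isomorphisms of $K$-modules, in each degree, natural in $M$ and in $N$: $$\mathrm{Tor}_*^{\Gamma(as)}(\bar b,M)\cong\mathrm{Tor}_*^{\Gamma(as)}(\mathcal L_{\Sigma_\bullet}(K),M)\cong\mathrm{Tor}_*^{\Delta^{op}}(K,\mathcal O(M)),$$ $$\mathrm{Tor}_*^{\mathcal F(as)}(b,N)\cong\mathrm{Tor}_*^{\mathcal F(as)}(\mathcal L_{\Sigma_\bullet}(K),N)\cong\mathrm{Tor}_*^{\Delta C^{op}}(K,\mathcal O(N)).$$ -/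

import Mathlib

open CategoryTheory Opposite
open scoped TensorProduct DirectSum

universe u

namespace FunctorTor

section Linear

variable (K : Type u) [CommRing K]

/-- The functor `K[Hom(X, -)]`. -/
noncomputable def linCorep {B : Type} [SmallCategory B] (X : B) : B ⥤ ModuleCat.{u} K where
  obj Y := ModuleCat.of K ((X ⟶ Y) →₀ K)
  map f := ModuleCat.ofHom (Finsupp.lmapDomain K K (fun g => g ≫ f))
  map_id Y := by
    ext : 1
    refine Finsupp.lhom_ext' fun g => LinearMap.ext_ring ?_
    simp
  map_comp f f' := by
    ext : 1
    refine Finsupp.lhom_ext' fun g => LinearMap.ext_ring ?_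
    simp

/-- The functor `K[Hom(-, X)]`. -/
noncomputable def linRep {B : Type} [SmallCategory B] (X : B) : Bᵒᵖ ⥤ ModuleCat.{u} K where
  obj Y := ModuleCat.of K ((Y.unop ⟶ X) →₀ K)
  map f := ModuleCat.ofHom (Finsupp.lmapDomain K K (fun g => f.unop ≫ g))
  map_id Y := by
    ext : 1
    refine Finsupp.lhom_ext' fun g => LinearMap.ext_ring ?_
    simp
  map_comp f f' := by
    ext : 1
    refine Finsupp.lhom_ext' fun g => LinearMap.ext_ring ?_
    simp

/-- Postcomposition `K[Hom(-, X)] ⟶ K[Hom(-, Y)]` with a morphism `X ⟶ Y`. -/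
noncomputable def linRepMap {B : Type} [SmallCategory B] {X Y : B} (f : X ⟶ Y) :
    linRep K X ⟶ linRep K Y where
  app Z := ModuleCat.ofHom (Finsupp.lmapDomain K K (fun g => g ≫ f))
  naturality Z Z' h := by
    ext : 1
    refine Finsupp.lhom_ext' fun g => LinearMap.ext_ring ?_
    change Finsupp.mapDomain (fun g => g ≫ f)
        (Finsupp.mapDomain (fun g => h.unop ≫ g) (Finsupp.single g (1 : K))) =
      Finsupp.mapDomain (fun g => h.unop ≫ g)
        (Finsupp.mapDomain (fun g => g ≫ f) (Finsupp.single g (1 : K)))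
    simp

variable {K}

/-- The morphism `K[Hom(X, -)] ⟶ N` given by an element of `N X`. -/
noncomputable def linCorepDesc {B : Type} [SmallCategory B] {X : B} (N : B ⥤ ModuleCat.{u} K)
    (n : N.obj X) : linCorep K X ⟶ N where
  app Y := ModuleCat.ofHom (Finsupp.linearCombination K fun g : X ⟶ Y => (N.map g).hom n)
  naturality Y Y' h := by
    ext : 1
    refine Finsupp.lhom_ext' fun g => LinearMap.ext_ring ?_
    change Finsupp.linearCombination K (fun g : X ⟶ Y' => (N.map g).hom n)
        (Finsupp.mapDomain (fun g => g ≫ h) (Finsupp.single g (1 : K))) =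
      (N.map h).hom (Finsupp.linearCombination K (fun g : X ⟶ Y => (N.map g).hom n)
        (Finsupp.single g (1 : K)))
    simp

lemma linCorepDesc_id {B : Type} [SmallCategory B] {X : B} (N : B ⥤ ModuleCat.{u} K)
    (n : N.obj X) : ((linCorepDesc N n).app X).hom (Finsupp.single (𝟙 X) (1 : K)) = n := by
  change Finsupp.linearCombination K (fun g : X ⟶ X => (N.map g).hom n)
    (Finsupp.single (𝟙 X) (1 : K)) = n
  simp

lemma linCorep_hom_ext {B : Type} [SmallCategory B] {X : B} {N : B ⥤ ModuleCat.{u} K}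
    (a b : linCorep K X ⟶ N)
    (h : (a.app X).hom (Finsupp.single (𝟙 X) (1 : K)) =
      (b.app X).hom (Finsupp.single (𝟙 X) (1 : K))) : a = b := by
  ext Y : 3
  refine Finsupp.lhom_ext' fun g => LinearMap.ext_ring ?_
  have key : ∀ c : linCorep K X ⟶ N, (c.app Y).hom (Finsupp.single g (1 : K)) =
      (N.map g).hom ((c.app X).hom (Finsupp.single (𝟙 X) (1 : K))) := by
    intro c
    have := congrArg (fun t => t.hom (Finsupp.single (𝟙 X) (1 : K))) (c.naturality g)
    change (c.app Y).hom (Finsupp.mapDomain (fun k => k ≫ g) (Finsupp.single (𝟙 X) (1 : K))) =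
      (N.map g).hom ((c.app X).hom (Finsupp.single (𝟙 X) (1 : K))) at this
    rwa [Finsupp.mapDomain_single, Category.id_comp] at this
  exact (key a).trans ((congrArg _ h).trans (key b).symm)

instance {B : Type} [SmallCategory B] (X : B) : Projective (linCorep K X) where
  factors {E N} f e he := by
    have : Function.Surjective (e.app X).hom :=
      (ModuleCat.epi_iff_surjective _).1 inferInstance
    obtain ⟨x, hx⟩ := this ((f.app X).hom (Finsupp.single (𝟙 X) (1 : K)))
    refine ⟨linCorepDesc E x, linCorep_hom_ext _ _ ?_⟩
    exact (congrArg (e.app X).hom (linCorepDesc_id E x)).trans hx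

/-- The category of `B`-modules has enough projectives. -/
instance {B : Type} [SmallCategory B] : EnoughProjectives (B ⥤ ModuleCat.{u} K) where
  presentation N := ⟨{
    p := ∐ fun s : Σ X : B, N.obj X => linCorep K s.1
    f := Limits.Sigma.desc fun s => linCorepDesc N s.2
    epi := by
      rw [NatTrans.epi_iff_epi_app]
      intro Y
      rw [ModuleCat.epi_iff_surjective]
      intro n
      let F : (Σ X : B, N.obj X) → (B ⥤ ModuleCat.{u} K) := fun s => linCorep K s.1
      refine ⟨((Limits.Sigma.ι F ⟨Y, n⟩).app Y).hom (Finsupp.single (𝟙 Y) (1 : K)), ?_⟩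
      have := congrArg (fun t => (t.app Y).hom (Finsupp.single (𝟙 Y) (1 : K)))
        (Limits.Sigma.ι_desc (f := F) (fun s => linCorepDesc N s.2) ⟨Y, n⟩)
      exact this.trans (linCorepDesc_id N n) }⟩

end Linear

section Tensor

variable {K : Type u} [CommRing K] {B : Type} [SmallCategory B]

/-- `⨁_X M(X) ⊗ N(X)`. -/
abbrev PreTensor (M : Bᵒᵖ ⥤ ModuleCat.{u} K) (N : B ⥤ ModuleCat.{u} K) : Type u :=
  ⨁ X : B, M.obj (op X) ⊗[K] N.obj X

open scoped Classical in
/-- The relations `M(Φ) m ⊗ n ∼ m ⊗ N(Φ) n`. -/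
noncomputable def tensorRel (M : Bᵒᵖ ⥤ ModuleCat.{u} K) (N : B ⥤ ModuleCat.{u} K) :
    Submodule K (PreTensor M N) :=
  Submodule.span K {z | ∃ (X Y : B) (Φ : X ⟶ Y) (m : M.obj (op Y)) (n : N.obj X),
    z = DirectSum.lof K B (fun X => M.obj (op X) ⊗[K] N.obj X) X ((M.map Φ.op).hom m ⊗ₜ n)
      - DirectSum.lof K B (fun X => M.obj (op X) ⊗[K] N.obj X) Y (m ⊗ₜ (N.map Φ).hom n)}

/-- The map on `⨁_X M(X) ⊗ N(X)` induced by morphisms in both variables. -/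
noncomputable def preTensorMap {M M' : Bᵒᵖ ⥤ ModuleCat.{u} K} {N N' : B ⥤ ModuleCat.{u} K}
    (a : M ⟶ M') (b : N ⟶ N') : PreTensor M N →ₗ[K] PreTensor M' N' :=
  DirectSum.lmap fun X => TensorProduct.map (a.app (op X)).hom (b.app X).hom

lemma preTensorMap_rel {M M' : Bᵒᵖ ⥤ ModuleCat.{u} K} {N N' : B ⥤ ModuleCat.{u} K}
    (a : M ⟶ M') (b : N ⟶ N') :
    tensorRel M N ≤ (tensorRel M' N').comap (preTensorMap a b) := by
  classical
  rw [tensorRel, Submodule.span_le]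
  rintro _ ⟨X, Y, Φ, m, n, rfl⟩
  refine Submodule.subset_span ⟨X, Y, Φ, (a.app (op Y)).hom m, (b.app X).hom n, ?_⟩
  have h1 := congrArg (fun t => t.hom m) (a.naturality Φ.op)
  have h2 := congrArg (fun t => t.hom n) (b.naturality Φ)
  simp only [ModuleCat.hom_comp, LinearMap.comp_apply] at h1 h2
  rw [map_sub, preTensorMap, DirectSum.lmap_lof, DirectSum.lmap_lof, TensorProduct.map_tmul,
    TensorProduct.map_tmul, ← h1, ← h2]

/-- The tensor product `M ⊗_B N` of a `Bᵒᵖ`-module and a `B`-module, as a bifunctor. -/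
noncomputable def tensor : (Bᵒᵖ ⥤ ModuleCat.{u} K) ⥤ (B ⥤ ModuleCat.{u} K) ⥤ ModuleCat.{u} K where
  obj M :=
    { obj N := ModuleCat.of K (PreTensor M N ⧸ tensorRel M N)
      map b := ModuleCat.ofHom (Submodule.mapQ _ _ _ (preTensorMap_rel (𝟙 M) b))
      map_id N := by
        classical
        ext : 1
        refine Submodule.linearMap_qext _ (DirectSum.linearMap_ext _ fun X =>
          TensorProduct.ext' fun m n => ?_)
        simp [preTensorMap]
      map_comp b b' := by
        classical
        ext : 1
        refine Submodule.linearMap_qext _ (DirectSum.linearMap_ext _ fun X =>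
          TensorProduct.ext' fun m n => ?_)
        simp [preTensorMap] }
  map a :=
    { app N := ModuleCat.ofHom (Submodule.mapQ _ _ _ (preTensorMap_rel a (𝟙 N)))
      naturality N N' b := by
        classical
        ext : 1
        refine Submodule.linearMap_qext _ (DirectSum.linearMap_ext _ fun X =>
          TensorProduct.ext' fun m n => ?_)
        simp [preTensorMap] }
  map_id M := by
    classical
    ext N : 3
    refine Submodule.linearMap_qext _ (DirectSum.linearMap_ext _ fun X =>
      TensorProduct.ext' fun m n => ?_)
    simp [preTensorMap]
  map_comp a a' := by
    classical
    ext N : 3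
    refine Submodule.linearMap_qext _ (DirectSum.linearMap_ext _ fun X =>
      TensorProduct.ext' fun m n => ?_)
    simp [preTensorMap]

instance (M : Bᵒᵖ ⥤ ModuleCat.{u} K) : ((tensor (K := K) (B := B)).obj M).Additive where
  map_add {N N' b b'} := by
    classical
    ext : 1
    refine Submodule.linearMap_qext _ (DirectSum.linearMap_ext _ fun X =>
      TensorProduct.ext' fun m n => ?_)
    change (tensorRel M N').mkQ (preTensorMap (𝟙 M) (b + b') (DirectSum.lof K B _ X (m ⊗ₜ n))) =
      (tensorRel M N').mkQ (preTensorMap (𝟙 M) b (DirectSum.lof K B _ X (m ⊗ₜ n))) +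
      (tensorRel M N').mkQ (preTensorMap (𝟙 M) b' (DirectSum.lof K B _ X (m ⊗ₜ n)))
    simp [preTensorMap, TensorProduct.tmul_add]

end Tensor

/-- `Tor_n^B(M, N)`, the homology of `M ⊗_B q_*` for a projective resolution `q_*` of `N`,
as a bifunctor. -/
noncomputable def functorTor (K : Type u) [CommRing K] (B : Type) [SmallCategory B] (n : ℕ) :
    (Bᵒᵖ ⥤ ModuleCat.{u} K) ⥤ (B ⥤ ModuleCat.{u} K) ⥤ ModuleCat.{u} K where
  obj M := (tensor.obj M).leftDerived n
  map a := NatTrans.leftDerived (tensor.map a) n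

section Crossed

variable {B C : Type} [SmallCategory B] [SmallCategory C]

/-- `B` is crossed by `C` and `D`: here `C` is a subcategory of `B` with the same objects,
given by its inclusion `ι`, and `D` is a subcategory of `B` with the same objects, given by the
set of its morphisms. Every morphism of `B` factors uniquely as one of `D` followed by one
of `C`, the intermediate object being unique as well. -/
structure IsCrossed (ι : C ⥤ B) (D : MorphismProperty B) : Prop where
  faithful : ι.Faithful
  bijective_obj : Function.Bijective ι.obj
  multiplicative : D.IsMultiplicative
  existsUnique_factor : ∀ {X : B} {Z : C} (Φ : X ⟶ ι.obj Z),
    ∃! t : Σ Y : C, (Y ⟶ Z) × {f : X ⟶ ι.obj Y // D f}, t.2.2.1 ≫ ι.map t.2.1 = Φ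

variable {ι : C ⥤ B} {D : MorphismProperty B}

/-- The factorization of `Φ : X ⟶ Z` as a triple `(Y, Ψ, f)` with `Φ = Ψ ∘ f`. -/
noncomputable def IsCrossed.factor (h : IsCrossed ι D) {X : B} {Z : C} (Φ : X ⟶ ι.obj Z) :
    Σ Y : C, (Y ⟶ Z) × {f : X ⟶ ι.obj Y // D f} :=
  (h.existsUnique_factor Φ).choose

lemma IsCrossed.factor_spec (h : IsCrossed ι D) {X : B} {Z : C} (Φ : X ⟶ ι.obj Z) :
    (h.factor Φ).2.2.1 ≫ ι.map (h.factor Φ).2.1 = Φ :=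
  (h.existsUnique_factor Φ).choose_spec.1

lemma IsCrossed.factor_eq (h : IsCrossed ι D) {X : B} {Z : C} (Φ : X ⟶ ι.obj Z)
    (t : Σ Y : C, (Y ⟶ Z) × {f : X ⟶ ι.obj Y // D f}) (ht : t.2.2.1 ≫ ι.map t.2.1 = Φ) :
    h.factor Φ = t :=
  ((h.existsUnique_factor Φ).choose_spec.2 t ht).symm

variable {K : Type u} [CommRing K]

/-- `⨁_A M(A) ⊗ K[Hom_D(X, A)]`. -/
abbrev PseudoFreeObj (ι : C ⥤ B) (D : MorphismProperty B) (M : Cᵒᵖ ⥤ ModuleCat.{u} K)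
    (X : B) : Type u :=
  ⨁ A : C, M.obj (op A) ⊗[K] ({g : X ⟶ ι.obj A // D g} →₀ K)

open scoped Classical in
/-- For a triple `t = (A', Ψ, f)` with `Ψ : A' ⟶ A` in `C` and `f : X ⟶ A'` in `D`, the map
`m ↦ m Ψ ⊗ f`. -/
noncomputable def pseudoFreeGen (M : Cᵒᵖ ⥤ ModuleCat.{u} K) {X : B} {A : C}
    (t : Σ A' : C, (A' ⟶ A) × {f : X ⟶ ι.obj A' // D f}) :
    M.obj (op A) →ₗ[K] PseudoFreeObj ι D M X :=
  DirectSum.lof K C (fun A => M.obj (op A) ⊗[K] ({g : X ⟶ ι.obj A // D g} →₀ K)) t.1 ∘ₗ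
    (TensorProduct.mk K _ _).flip (Finsupp.single t.2.2 1) ∘ₗ (M.map t.2.1.op).hom

open scoped Classical in
/-- The action of `Φ : X ⟶ Y`: if `g ∘ Φ = Ψ ∘ f` is the factorization of `g ∘ Φ`, then
`(m ⊗ g) Φ = m Ψ ⊗ f`. If `Φ = Ψ₀ ∘ f₀`, then `Ψ = g_*(Ψ₀)` and `f = Ψ₀^*(g) ∘ f₀`. -/
noncomputable def IsCrossed.pseudoFreeAct (h : IsCrossed ι D) (M : Cᵒᵖ ⥤ ModuleCat.{u} K)
    {X Y : B} (Φ : X ⟶ Y) : PseudoFreeObj ι D M Y →ₗ[K] PseudoFreeObj ι D M X :=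
  DirectSum.toModule K C _ fun A => TensorProduct.lift
    (Finsupp.linearCombination K fun g : {g : Y ⟶ ι.obj A // D g} =>
      pseudoFreeGen M (h.factor (Φ ≫ g.1))).flip

open scoped Classical in
lemma IsCrossed.pseudoFreeAct_lof (h : IsCrossed ι D) (M : Cᵒᵖ ⥤ ModuleCat.{u} K)
    {X Y : B} (Φ : X ⟶ Y) {A : C} (m : M.obj (op A)) (g : {g : Y ⟶ ι.obj A // D g}) :
    h.pseudoFreeAct M Φ (DirectSum.lof K C
      (fun A => M.obj (op A) ⊗[K] ({g : Y ⟶ ι.obj A // D g} →₀ K)) A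
        (m ⊗ₜ Finsupp.single g 1)) = pseudoFreeGen M (h.factor (Φ ≫ g.1)) m := by
  simp [IsCrossed.pseudoFreeAct]

open scoped Classical in
lemma pseudoFree_ext {M : Cᵒᵖ ⥤ ModuleCat.{u} K} {X : B} {V : Type*} [AddCommGroup V]
    [Module K V] {a b : PseudoFreeObj ι D M X →ₗ[K] V}
    (hab : ∀ (A : C) (m : M.obj (op A)) (g : {g : X ⟶ ι.obj A // D g}),
      a (DirectSum.lof K C (fun A => M.obj (op A) ⊗[K] ({g : X ⟶ ι.obj A // D g} →₀ K)) A
        (m ⊗ₜ Finsupp.single g 1)) =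
      b (DirectSum.lof K C (fun A => M.obj (op A) ⊗[K] ({g : X ⟶ ι.obj A // D g} →₀ K)) A
        (m ⊗ₜ Finsupp.single g 1))) : a = b := by
  refine DirectSum.linearMap_ext _ fun A => TensorProduct.ext ?_
  ext m g
  exact hab A m g

/-- The pseudo-free functor `L_D : Cᵒᵖ-Mod ⥤ Bᵒᵖ-Mod`. -/
noncomputable def IsCrossed.pseudoFree (K : Type u) [CommRing K] (h : IsCrossed ι D) :
    (Cᵒᵖ ⥤ ModuleCat.{u} K) ⥤ (Bᵒᵖ ⥤ ModuleCat.{u} K) where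
  obj M :=
    { obj X := ModuleCat.of K (PseudoFreeObj ι D M X.unop)
      map Φ := ModuleCat.ofHom (h.pseudoFreeAct M Φ.unop)
      map_id X := by
        classical
        ext : 1
        refine pseudoFree_ext fun A m g => ?_
        rw [ModuleCat.hom_ofHom, h.pseudoFreeAct_lof,
          h.factor_eq _ ⟨A, 𝟙 A, g⟩ (by simp)]
        simp [pseudoFreeGen]
      map_comp {X Y Z} Φ Φ' := by
        classical
        ext : 1
        refine pseudoFree_ext fun A m g => ?_
        have e : h.factor ((Φ ≫ Φ').unop ≫ g.1) =
            ⟨_, (h.factor (Φ'.unop ≫ (h.factor (Φ.unop ≫ g.1)).2.2.1)).2.1 ≫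
              (h.factor (Φ.unop ≫ g.1)).2.1,
              (h.factor (Φ'.unop ≫ (h.factor (Φ.unop ≫ g.1)).2.2.1)).2.2⟩ := by
          apply h.factor_eq
          simp only [Functor.map_comp, unop_comp, Category.assoc]
          rw [← Category.assoc, h.factor_spec, Category.assoc, h.factor_spec]
        rw [ModuleCat.hom_comp, ModuleCat.hom_ofHom, ModuleCat.hom_ofHom, ModuleCat.hom_ofHom,
          LinearMap.comp_apply, h.pseudoFreeAct_lof, h.pseudoFreeAct_lof, e]
        conv_rhs => rw [pseudoFreeGen]
        simp only [LinearMap.comp_apply, LinearMap.flip_apply, TensorProduct.mk_apply]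
        rw [h.pseudoFreeAct_lof]
        simp [pseudoFreeGen] }
  map {M M'} a :=
    { app X := ModuleCat.ofHom
        (DirectSum.lmap fun A => LinearMap.rTensor _ (a.app (op A)).hom)
      naturality X Y Φ := by
        classical
        ext : 1
        refine pseudoFree_ext fun A m g => ?_
        simp only [ModuleCat.hom_comp, ModuleCat.hom_ofHom, LinearMap.comp_apply]
        rw [h.pseudoFreeAct_lof, DirectSum.lmap_lof, LinearMap.rTensor_tmul, h.pseudoFreeAct_lof]
        simp only [pseudoFreeGen, LinearMap.comp_apply, LinearMap.flip_apply,
          TensorProduct.mk_apply]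
        rw [DirectSum.lmap_lof, LinearMap.rTensor_tmul]
        have := congrArg (fun t => t.hom m)
          (a.naturality (h.factor (Φ.unop ≫ g.1)).2.1.op)
        simp only [ModuleCat.hom_comp, LinearMap.comp_apply] at this
        rw [this] }
  map_id M := by
    classical
    ext X : 3
    refine pseudoFree_ext fun A m g => ?_
    simp
  map_comp a a' := by
    classical
    ext X : 3
    refine pseudoFree_ext fun A m g => ?_
    simp

/-- `L` and `R` are pseudo-adjoint: the bifunctors `L(-) ⊗_B -` and `- ⊗_C R(-)` are naturally
isomorphic. -/
def IsPseudoAdjoint (L : (Cᵒᵖ ⥤ ModuleCat.{u} K) ⥤ (Bᵒᵖ ⥤ ModuleCat.{u} K))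
    (R : (B ⥤ ModuleCat.{u} K) ⥤ (C ⥤ ModuleCat.{u} K)) : Prop :=
  Nonempty (L ⋙ tensor ≅ tensor ⋙ (Functor.whiskeringLeft _ _ _).obj R)

/-- The forgetful functor `O : B-Mod ⥤ C-Mod`. -/
abbrev forgetTo (K : Type u) [CommRing K] (ι : C ⥤ B) :
    (B ⥤ ModuleCat.{u} K) ⥤ (C ⥤ ModuleCat.{u} K) :=
  (Functor.whiskeringLeft _ _ _).obj ι

/-- The trivial module. -/
noncomputable abbrev trivialModule (K : Type u) [CommRing K] (E : Type) [SmallCategory E] :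
    E ⥤ ModuleCat.{u} K :=
  (Functor.const E).obj (ModuleCat.of K K)

end Crossed

/-- An object `[n] = {0, …, n}` of the category `F(as)`. -/
structure FAs where
  len : ℕ

/-- A morphism of `F(as)`: a map of sets together with a total order on each fibre. The orders
are recorded as one relation `fibreLE` that only relates elements of the same fibre. -/
@[ext]
structure FAs.Hom (X Y : FAs) where
  toFun : Fin (X.len + 1) → Fin (Y.len + 1)
  fibreLE : Fin (X.len + 1) → Fin (X.len + 1) → Prop
  map_eq : ∀ {x y}, fibreLE x y → toFun x = toFun y
  refl : ∀ x, fibreLE x x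
  trans : ∀ {x y z}, fibreLE x y → fibreLE y z → fibreLE x z
  antisymm : ∀ {x y}, fibreLE x y → fibreLE y x → x = y
  total : ∀ {x y}, toFun x = toFun y → fibreLE x y ∨ fibreLE y x

/-- In a composite `g ∘ f`, the fibre over `z` is the concatenation of the fibres of `f` over the
elements of the fibre of `g` over `z`, in their order. -/
instance : SmallCategory FAs where
  Hom := FAs.Hom
  id X :=
    { toFun := id
      fibreLE := Eq
      map_eq := id
      refl := fun _ => rfl
      trans := Eq.trans
      antisymm := fun h _ => h
      total := Or.inl }
  comp f g :=
    { toFun := g.toFun ∘ f.toFun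
      fibreLE x y := g.fibreLE (f.toFun x) (f.toFun y) ∧ (f.toFun x = f.toFun y → f.fibreLE x y)
      map_eq := fun h => g.map_eq h.1
      refl := fun x => ⟨g.refl _, fun _ => f.refl _⟩
      trans := by
        rintro x y z ⟨h1, h2⟩ ⟨h3, h4⟩
        refine ⟨g.trans h1 h3, fun e => ?_⟩
        have e1 : f.toFun x = f.toFun y := g.antisymm h1 (e ▸ h3)
        exact f.trans (h2 e1) (h4 (e1 ▸ e))
      antisymm := by
        rintro x y ⟨h1, h2⟩ ⟨h3, h4⟩
        have e := g.antisymm h1 h3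
        exact f.antisymm (h2 e) (h4 e.symm)
      total := by
        intro x y h
        by_cases e : f.toFun x = f.toFun y
        · rcases f.total e with h' | h'
          · exact Or.inl ⟨e ▸ g.refl _, fun _ => h'⟩
          · exact Or.inr ⟨e ▸ g.refl _, fun _ => h'⟩
        · rcases g.total h with h' | h'
          · exact Or.inl ⟨h', fun e' => absurd e' e⟩
          · exact Or.inr ⟨h', fun e' => absurd e'.symm e⟩ }
  id_comp f := by
    apply FAs.Hom.ext
    · rfl
    · funext x y
      exact propext ⟨fun h => h.1, fun h => ⟨h, fun e => e⟩⟩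
  comp_id f := by
    apply FAs.Hom.ext
    · rfl
    · funext x y
      exact propext ⟨fun h => h.2 h.1, fun h => ⟨f.map_eq h, fun _ => h⟩⟩
  assoc f g h := by
    apply FAs.Hom.ext
    · rfl
    · funext x y
      refine propext ⟨fun ⟨h1, h2⟩ => ⟨⟨h1, fun e => ?_⟩, fun e => ?_⟩,
        fun ⟨⟨h1, h2⟩, h3⟩ => ⟨h1, fun e => ⟨h2 e, h3⟩⟩⟩
      · exact (h2 e).1
      · exact (h2 (congrArg g.toFun e)).2 e

lemma FAs.hom_ext {X Y : FAs} {f g : X ⟶ Y} (h1 : f.toFun = g.toFun) (h2 : f.fibreLE = g.fibreLE) :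
    f = g :=
  FAs.Hom.ext h1 h2

/-- The morphisms of `F(as)` that send `0` to `0`. -/
def FAs.pointed : MorphismProperty FAs := fun _ _ f => f.toFun 0 = 0

instance : FAs.pointed.IsMultiplicative where
  id_mem _ := rfl
  comp_mem f g hf hg := by
    change g.toFun (f.toFun 0) = 0
    rw [show f.toFun 0 = 0 from hf]
    exact hg

/-- The category `Γ(as)`. -/
abbrev GammaAs : Type := WideSubcategory FAs.pointed

/-- The morphisms of the subcategory `Σ_•` of `F(as)`, the groupoid whose morphisms are the
permutations of `[n]` that fix `0`. -/
def FAs.sigma : MorphismProperty FAs := fun _ _ f => Function.Bijective f.toFun ∧ f.toFun 0 = 0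

/-- The morphisms of the subcategory `Σ_•` of `Γ(as)`. -/
def GammaAs.sigma : MorphismProperty GammaAs := fun _ _ f => Function.Bijective f.hom.toFun

/-- An object `[n]` of the cyclic category `ΔC`. -/
structure CyclicCat where
  len : ℕ

/-- A nondecreasing map `f : ℤ → ℤ` with `f (i + n + 1) = f i + m + 1`. -/
@[ext]
structure PeriodicMap (n m : ℕ) where
  toFun : ℤ → ℤ
  monotone : Monotone toFun
  map_add_period : ∀ i, toFun (i + (n + 1)) = toFun i + (m + 1)

namespace PeriodicMap

variable {n m l : ℕ}

lemma map_add_mul (f : PeriodicMap n m) (i c : ℤ) :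
    f.toFun (i + c * (n + 1)) = f.toFun i + c * (m + 1) := by
  induction c using Int.induction_on with
  | zero => simp
  | succ k ih =>
    have := f.map_add_period (i + k * (n + 1))
    rw [ih] at this
    rw [show i + ((k : ℤ) + 1) * (n + 1) = i + k * (n + 1) + (n + 1) by ring, this]
    ring
  | pred k ih =>
    have := f.map_add_period (i + (-(k : ℤ) - 1) * (n + 1))
    rw [show i + (-(k : ℤ) - 1) * (n + 1) + (n + 1) = i + (-(k : ℤ)) * (n + 1) by ring, ih] at this
    linarith

/-- The identity. -/
def id (n : ℕ) : PeriodicMap n n := ⟨fun i => i, fun _ _ h => h, fun _ => rfl⟩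

/-- The composite `g ∘ f`. -/
def comp (f : PeriodicMap n m) (g : PeriodicMap m l) : PeriodicMap n l :=
  ⟨fun i => g.toFun (f.toFun i), fun _ _ h => g.monotone (f.monotone h),
    fun i => by rw [f.map_add_period, g.map_add_period]⟩

/-- Two maps are equivalent if they differ by a multiple of the period of the target. -/
instance setoid (n m : ℕ) : Setoid (PeriodicMap n m) where
  r f g := ∃ c : ℤ, ∀ i, g.toFun i = f.toFun i + c * (m + 1)
  iseqv :=
    { refl := fun f => ⟨0, fun i => by simp⟩
      symm := fun ⟨c, h⟩ => ⟨-c, fun i => by rw [h]; ring⟩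
      trans := fun ⟨c, h⟩ ⟨d, k⟩ => ⟨c + d, fun i => by rw [k, h]; ring⟩ }

lemma comp_equiv {f f' : PeriodicMap n m} {g g' : PeriodicMap m l} (hf : f ≈ f') (hg : g ≈ g') :
    f.comp g ≈ f'.comp g' := by
  obtain ⟨c, hc⟩ := hf
  obtain ⟨d, hd⟩ := hg
  refine ⟨c + d, fun i => ?_⟩
  simp only [comp]
  rw [hd, hc, map_add_mul]
  ring

lemma exists_least (f : PeriodicMap n m) (j : ℤ) :
    ∃ i, j ≤ f.toFun i ∧ ∀ k, j ≤ f.toFun k → i ≤ k := by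
  apply Int.exists_least_of_bdd (P := fun i => j ≤ f.toFun i)
  · refine ⟨-(|j - f.toFun 0| + 1) * (n + 1), fun k hk => ?_⟩
    by_contra! hlt
    have h1 := f.monotone hlt.le
    have h2 := f.map_add_mul 0 (-(|j - f.toFun 0| + 1))
    rw [zero_add] at h2
    rw [h2] at h1
    have h3 := neg_abs_le (j - f.toFun 0)
    have h4 := abs_nonneg (j - f.toFun 0)
    nlinarith
  · refine ⟨|j - f.toFun 0| * (n + 1), ?_⟩
    have h2 := f.map_add_mul 0 |j - f.toFun 0|
    rw [zero_add] at h2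
    rw [h2]
    have h3 := le_abs_self (j - f.toFun 0)
    have h4 := abs_nonneg (j - f.toFun 0)
    nlinarith

/-- The least `i` with `j ≤ f i`. -/
noncomputable def adjFun (f : PeriodicMap n m) (j : ℤ) : ℤ := (f.exists_least j).choose

lemma adjFun_le_iff (f : PeriodicMap n m) (i j : ℤ) : f.adjFun j ≤ i ↔ j ≤ f.toFun i :=
  ⟨fun h => (f.exists_least j).choose_spec.1.trans (f.monotone h),
    fun h => (f.exists_least j).choose_spec.2 i h⟩

/-- The left adjoint `f^*` of `f`, with `f^* j` the least `i` such that `j ≤ f i`. -/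
noncomputable def adj (f : PeriodicMap n m) : PeriodicMap m n where
  toFun := f.adjFun
  monotone j j' h := (f.adjFun_le_iff _ _).2 (h.trans ((f.adjFun_le_iff _ _).1 le_rfl))
  map_add_period j := by
    refine eq_of_forall_ge_iff fun i => ?_
    have h := f.map_add_mul i (-1)
    rw [f.adjFun_le_iff, ← le_sub_iff_add_le, ← le_sub_iff_add_le, f.adjFun_le_iff,
      show i - ((n : ℤ) + 1) = i + -1 * (n + 1) by ring, h]
    constructor <;> intro h <;> linarith

lemma adj_le_iff (f : PeriodicMap n m) (i j : ℤ) : f.adj.toFun j ≤ i ↔ j ≤ f.toFun i :=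
  f.adjFun_le_iff i j

lemma adj_id (n : ℕ) : (id n).adj = id n := by
  ext j
  refine eq_of_forall_ge_iff fun i => ?_
  rw [adj_le_iff]
  rfl

lemma adj_comp (f : PeriodicMap n m) (g : PeriodicMap m l) :
    (f.comp g).adj = g.adj.comp f.adj := by
  ext j
  refine eq_of_forall_ge_iff fun i => ?_
  rw [adj_le_iff]
  change _ ↔ f.adj.toFun (g.adj.toFun j) ≤ i
  rw [adj_le_iff, adj_le_iff]
  rfl

lemma adj_equiv {f f' : PeriodicMap n m} (h : f ≈ f') : f.adj ≈ f'.adj := by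
  obtain ⟨c, hc⟩ := h
  refine ⟨-c, fun j => eq_of_forall_ge_iff fun i => ?_⟩
  rw [adj_le_iff, hc, ← le_sub_iff_add_le, adj_le_iff,
    show i - -c * ((n : ℤ) + 1) = i + c * (n + 1) by ring, map_add_mul]

end PeriodicMap

/-- The cyclic category `ΔC`: a morphism `[n] ⟶ [m]` is a nondecreasing map `f : ℤ → ℤ` with
`f (i + n + 1) = f i + m + 1`, up to adding a multiple of `m + 1`. -/
instance : SmallCategory CyclicCat where
  Hom X Y := Quotient (PeriodicMap.setoid X.len Y.len)
  id X := ⟦PeriodicMap.id X.len⟧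
  comp f g := Quotient.map₂ PeriodicMap.comp
    (fun _ _ hf _ _ hg => PeriodicMap.comp_equiv hf hg) f g
  id_comp f := by
    induction f using Quotient.inductionOn
    rfl
  comp_id f := by
    induction f using Quotient.inductionOn
    rfl
  assoc f g h := by
    induction f using Quotient.inductionOn
    induction g using Quotient.inductionOn
    induction h using Quotient.inductionOn
    rfl

/-- The residue of `i` modulo `n + 1`, in `{0, …, n}`. -/
def residue (n : ℕ) (i : ℤ) : Fin (n + 1) :=
  ⟨(i % (n + 1)).toNat, by
    have h1 := Int.emod_nonneg i (show (n : ℤ) + 1 ≠ 0 by omega)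
    have h2 := Int.emod_lt_of_pos i (show (0 : ℤ) < n + 1 by omega)
    omega⟩

lemma residue_coe (n : ℕ) (i : ℤ) : ((residue n i : ℕ) : ℤ) = i % (n + 1) :=
  Int.toNat_of_nonneg (Int.emod_nonneg i (by omega))

lemma residue_val (n : ℕ) (x : Fin (n + 1)) : residue n (x : ℕ) = x := by
  apply Fin.ext
  have := residue_coe n (x : ℕ)
  rw [Int.emod_eq_of_lt (by omega) (by omega)] at this
  omega

lemma residue_eq_iff (n : ℕ) (i j : ℤ) :
    residue n i = residue n j ↔ ∃ c : ℤ, j = i + c * (n + 1) := by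
  rw [Fin.ext_iff, ← Int.natCast_inj, residue_coe, residue_coe]
  constructor
  · intro h
    obtain ⟨c, hc⟩ := Int.ModEq.dvd h
    exact ⟨c, by rw [mul_comm c]; linarith⟩
  · rintro ⟨c, rfl⟩
    rw [Int.add_mul_emod_self_right]

lemma exists_residue_eq (n : ℕ) (x : Fin (n + 1)) : ∃ i, residue n i = x := ⟨_, residue_val n x⟩

namespace PeriodicMap

variable {n m l : ℕ}

lemma residue_map_congr (f : PeriodicMap n m) {i j : ℤ} (h : residue n i = residue n j) :
    residue m (f.toFun i) = residue m (f.toFun j) := by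
  obtain ⟨c, rfl⟩ := (residue_eq_iff _ _ _).1 h
  exact (residue_eq_iff _ _ _).2 ⟨c, f.map_add_mul i c⟩

lemma exists_lift (f : PeriodicMap n m) {i p : ℤ} (h : residue m (f.toFun i) = residue m p) :
    ∃ i', residue n i' = residue n i ∧ f.toFun i' = p := by
  obtain ⟨c, rfl⟩ := (residue_eq_iff _ _ _).1 h
  exact ⟨i + c * (n + 1), ((residue_eq_iff _ _ _).2 ⟨c, rfl⟩).symm, f.map_add_mul i c⟩

lemma le_of_lifts (f : PeriodicMap n m) {i j i' j' : ℤ} (hi : residue n i = residue n i')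
    (hj : residue n j = residue n j') (h : i ≤ j) (e : f.toFun i = f.toFun j)
    (e' : f.toFun i' = f.toFun j') : i' ≤ j' := by
  obtain ⟨a, rfl⟩ := (residue_eq_iff _ _ _).1 hi
  obtain ⟨b, rfl⟩ := (residue_eq_iff _ _ _).1 hj
  rw [f.map_add_mul, f.map_add_mul, e] at e'
  have : a = b := mul_right_cancel₀ (show (m : ℤ) + 1 ≠ 0 by omega) (add_left_cancel e')
  subst this
  linarith

/-- The morphism of `F(as)` defined by `f`: the map induced by `f` on residues, where the fibre
over the residue of `p` is ordered as the fibre of `f` over `p` in `ℤ`. -/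
def toFAs (f : PeriodicMap n m) : (⟨n⟩ : FAs) ⟶ ⟨m⟩ :=
  FAs.Hom.mk (X := ⟨n⟩) (Y := ⟨m⟩)
    (toFun := fun x => residue m (f.toFun (x : ℕ)))
    (fibreLE := fun x y => ∃ i j, residue n i = x ∧ residue n j = y ∧ i ≤ j ∧
      f.toFun i = f.toFun j)
    (map_eq := by
      rintro x y ⟨i, j, rfl, rfl, h, e⟩
      rw [f.residue_map_congr (residue_val n (residue n i)),
        f.residue_map_congr (residue_val n (residue n j)), e])
    (refl := fun x => ⟨_, _, residue_val n x, residue_val n x, le_rfl, rfl⟩)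
    (trans := by
      rintro x y z ⟨i, j, rfl, rfl, h, e⟩ ⟨i', j', hi', rfl, h', e'⟩
      obtain ⟨c, rfl⟩ := (residue_eq_iff _ _ _).1 hi'
      refine ⟨i, j' + c * (n + 1), rfl, ((residue_eq_iff _ _ _).2 ⟨c, rfl⟩).symm, by linarith, ?_⟩
      rw [e, f.map_add_mul, f.map_add_mul, e'])
    (antisymm := by
      rintro x y ⟨i, j, rfl, rfl, h, e⟩ ⟨j', i', hj, hi, h', e'⟩
      rw [le_antisymm h (f.le_of_lifts hj hi h' e' e.symm)])
    (total := by
      intro x y h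
      obtain ⟨i, hi, e⟩ := f.exists_lift h
      rw [residue_val] at hi
      rcases le_total i (y : ℕ) with h' | h'
      · exact Or.inl ⟨_, _, hi, residue_val n y, h', e⟩
      · exact Or.inr ⟨_, _, residue_val n y, hi, h', e.symm⟩)

lemma toFAs_toFun (f : PeriodicMap n m) (i : ℤ) :
    f.toFAs.toFun (residue n i) = residue m (f.toFun i) :=
  f.residue_map_congr (residue_val n (residue n i))

lemma toFAs_id (n : ℕ) : (id n).toFAs = 𝟙 _ := by
  apply FAs.hom_ext
  · funext x
    exact residue_val n x
  · funext x y
    refine propext ⟨?_, fun h => ?_⟩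
    · rintro ⟨i, j, rfl, rfl, h, e⟩
      exact congrArg _ e
    · exact ⟨_, _, residue_val n x, (residue_val n x).trans h, le_rfl, rfl⟩

lemma toFAs_comp (f : PeriodicMap n m) (g : PeriodicMap m l) :
    (f.comp g).toFAs = f.toFAs ≫ g.toFAs := by
  apply FAs.hom_ext
  · funext x
    exact (g.toFAs_toFun _).symm
  · funext x y
    obtain ⟨x, rfl⟩ := exists_residue_eq n x
    obtain ⟨y, rfl⟩ := exists_residue_eq n y
    refine propext ⟨?_, ?_⟩
    · rintro ⟨i, j, hi, hj, h, e⟩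
      rw [← hi, ← hj]
      refine ⟨⟨f.toFun i, f.toFun j, (f.toFAs_toFun i).symm, (f.toFAs_toFun j).symm,
        f.monotone h, e⟩, fun h' => ⟨i, j, rfl, rfl, h, ?_⟩⟩
      erw [f.toFAs_toFun, f.toFAs_toFun] at h'
      obtain ⟨c, hc⟩ := (residue_eq_iff _ _ _).1 h'
      have e' : g.toFun (f.toFun i) = g.toFun (f.toFun j) := e
      rw [hc, g.map_add_mul] at e'
      have : c * ((l : ℤ) + 1) = 0 := by linarith
      rcases mul_eq_zero.1 this with h0 | h0
      · rw [hc, h0]; ring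
      · omega
    · rintro ⟨⟨p, q, hp, hq, h, e⟩, h2⟩
      have h2' : f.toFAs.toFun (residue n x) = f.toFAs.toFun (residue n y) →
        f.toFAs.fibreLE (residue n x) (residue n y) := h2
      rw [f.toFAs_toFun, f.toFAs_toFun] at h2'
      obtain ⟨i, hi, rfl⟩ := f.exists_lift ((f.toFAs_toFun x).symm.trans hp.symm)
      obtain ⟨j, hj, rfl⟩ := f.exists_lift ((f.toFAs_toFun y).symm.trans hq.symm)
      rcases le_or_gt i j with hij | hij
      · exact ⟨i, j, hi, hj, hij, e⟩
      · have e2 := le_antisymm h (f.monotone hij.le)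
        obtain ⟨i', j', hi', hj', h', e'⟩ := h2' (by
          rw [← f.residue_map_congr hi, ← f.residue_map_congr hj, e2])
        exact ⟨i, j, hi, hj, f.le_of_lifts (hi'.trans hi.symm) (hj'.trans hj.symm) h' e' e2, e⟩

lemma toFAs_congr {f f' : PeriodicMap n m} (h : f ≈ f') : f.toFAs = f'.toFAs := by
  obtain ⟨c, hc⟩ := h
  apply FAs.hom_ext
  · funext x
    exact (residue_eq_iff _ _ _).2 ⟨c, hc _⟩
  · funext x y
    refine propext ⟨?_, ?_⟩
    · rintro ⟨i, j, hi, hj, h, e⟩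
      exact ⟨i, j, hi, hj, h, by rw [hc, hc, e]⟩
    · rintro ⟨i, j, hi, hj, h, e⟩
      rw [hc, hc] at e
      exact ⟨i, j, hi, hj, h, add_right_cancel e⟩

end PeriodicMap

/-- The inclusion `ΔCᵒᵖ ⥤ F(as)`. It sends the class of `f` to the morphism defined by `f^*`. On
generators, `d_i ↦ σ_i` for `0 ≤ i < n`, `d_n ↦ σ_0 ∘ t`, `s_i ↦ δ_{i+1}`, where `t` is the
permutation `i ↦ i + 1` modulo `n + 1`. -/
noncomputable def cyclicInclusion : CyclicCatᵒᵖ ⥤ FAs where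
  obj X := ⟨X.unop.len⟩
  map f := Quotient.lift (fun g => g.adj.toFAs)
    (fun _ _ h => PeriodicMap.toFAs_congr (PeriodicMap.adj_equiv h)) f.unop
  map_id X := by
    change (PeriodicMap.id _).adj.toFAs = _
    rw [PeriodicMap.adj_id, PeriodicMap.toFAs_id]
  map_comp {X Y Z} f g := by
    obtain ⟨f⟩ := f
    obtain ⟨g⟩ := g
    induction f using Quotient.inductionOn with | _ f
    induction g using Quotient.inductionOn with | _ g
    change (g.comp f).adj.toFAs = f.adj.toFAs ≫ g.adj.toFAs
    rw [PeriodicMap.adj_comp, PeriodicMap.toFAs_comp]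

/-- The periodic extension of a nondecreasing map `[n] → [m]`. -/
def periodicExtension {n m : ℕ} (a : Fin (n + 1) →o Fin (m + 1)) : PeriodicMap n m where
  toFun i := (a (residue n i) : ℕ) + (i / (n + 1)) * (m + 1)
  monotone i j h := by
    have hn : (0 : ℤ) < n + 1 := by omega
    have hd := Int.ediv_le_ediv hn h
    rcases hd.eq_or_lt with e | e
    · have : residue n i ≤ residue n j := by
        have hi := residue_coe n i
        have hj := residue_coe n j
        have h1 := Int.emod_add_mul_ediv i (n + 1)
        have h2 := Int.emod_add_mul_ediv j (n + 1)
        rw [Fin.le_def]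
        rw [e] at h1
        omega
      have := a.monotone this
      rw [Fin.le_def] at this
      dsimp only
      rw [e]
      omega
    · have h1 := (a (residue n i)).2
      dsimp only
      have h2 : (i / (n + 1) + 1) * ((m : ℤ) + 1) ≤ (j / (n + 1)) * (m + 1) :=
        mul_le_mul_of_nonneg_right e (by omega)
      rw [add_mul] at h2
      omega
  map_add_period i := by
    have h1 : residue n (i + (n + 1)) = residue n i :=
      ((residue_eq_iff _ _ _).2 ⟨1, by ring⟩).symm
    have h2 : (i + ((n : ℤ) + 1)) / (n + 1) = i / (n + 1) + 1 :=
      Int.add_ediv_of_dvd_right (dvd_refl _) |>.trans (by rw [Int.ediv_self (by omega)])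
    rw [h1, h2]
    ring

lemma periodicExtension_residue {n m : ℕ} (a : Fin (n + 1) →o Fin (m + 1)) (i : ℤ) :
    residue m ((periodicExtension a).toFun i) = a (residue n i) := by
  rw [← residue_val m (a (residue n i))]
  exact ((residue_eq_iff _ _ _).2 ⟨_, rfl⟩).symm

lemma periodicExtension_ediv {n m : ℕ} (a : Fin (n + 1) →o Fin (m + 1)) (i : ℤ) :
    (periodicExtension a).toFun i / (m + 1) = i / (n + 1) := by
  change ((a (residue n i) : ℕ) + (i / (n + 1)) * (m + 1) : ℤ) / (m + 1) = _
  rw [Int.add_mul_ediv_right _ _ (by omega), Int.ediv_eq_zero_of_lt (by omega) (by omega), zero_add]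

/-- The inclusion `Δ ⥤ ΔC`. -/
def simplexToCyclic : SimplexCategory ⥤ CyclicCat where
  obj X := ⟨X.len⟩
  map f := ⟦periodicExtension f.toOrderHom⟧
  map_id X := by
    refine congrArg _ (PeriodicMap.ext (funext fun i => ?_))
    change ((residue X.len i : ℕ) : ℤ) + (i / (X.len + 1)) * (X.len + 1) = i
    rw [residue_coe, mul_comm, Int.emod_add_mul_ediv]
  map_comp {X Y Z} f g := by
    refine congrArg _ (PeriodicMap.ext (funext fun i => ?_))
    change _ = ((g.toOrderHom (residue Y.len ((periodicExtension f.toOrderHom).toFun i)) : ℕ) : ℤ) +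
      (periodicExtension f.toOrderHom).toFun i / (Y.len + 1) * (Z.len + 1)
    rw [periodicExtension_residue, periodicExtension_ediv]
    rfl

lemma pointed_periodicExtension {n m : ℕ} (a : Fin (n + 1) →o Fin (m + 1)) :
    FAs.pointed (periodicExtension a).adj.toFAs := by
  change residue n ((periodicExtension a).adj.toFun ((0 : Fin (m + 1)) : ℕ)) = 0
  have : (periodicExtension a).adj.toFun ((0 : Fin (m + 1)) : ℕ) = ((0 : Fin (n + 1)) : ℕ) := by
    refine eq_of_forall_ge_iff fun i => ?_
    rw [PeriodicMap.adj_le_iff]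
    simp only [Fin.val_zero, Nat.cast_zero]
    rw [← Int.ediv_nonneg_iff_of_pos (show (0 : ℤ) < m + 1 by omega), periodicExtension_ediv,
      Int.ediv_nonneg_iff_of_pos (by omega)]
  rw [this, residue_val]

/-- The inclusion `Δᵒᵖ ⥤ Γ(as)`, the restriction of the inclusion `ΔCᵒᵖ ⥤ F(as)`. -/
noncomputable def simplicialInclusion : SimplexCategoryᵒᵖ ⥤ GammaAs where
  obj X := ⟨(simplexToCyclic.op ⋙ cyclicInclusion).obj X⟩
  map f := ⟨(simplexToCyclic.op ⋙ cyclicInclusion).map f, pointed_periodicExtension _⟩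
  map_id X := WideSubcategory.hom_ext _ ((simplexToCyclic.op ⋙ cyclicInclusion).map_id X)
  map_comp f g := WideSubcategory.hom_ext _ ((simplexToCyclic.op ⋙ cyclicInclusion).map_comp f g)

/-- The morphism `d_0 : [1] ⟶ [0]` of `F(as)`, with the order `0 < 1` on the fibre. -/
def FAs.d0 : (⟨1⟩ : FAs) ⟶ ⟨0⟩ :=
  FAs.Hom.mk (X := ⟨1⟩) (Y := ⟨0⟩) (fun _ => 0) (fun x y => x ≤ y) (fun _ => rfl) le_refl
    le_trans le_antisymm (fun {x y} _ => le_total x y)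

/-- The morphism `d_1 : [1] ⟶ [0]` of `F(as)`, with the order `1 < 0` on the fibre. -/
def FAs.d1 : (⟨1⟩ : FAs) ⟶ ⟨0⟩ :=
  FAs.Hom.mk (X := ⟨1⟩) (Y := ⟨0⟩) (fun _ => 0) (fun x y => y ≤ x) (fun _ => rfl) le_refl
    (fun h h' => le_trans h' h) (fun h h' => le_antisymm h' h) (fun {x y} _ => le_total y x)

/-- `d_0` as a morphism of `Γ(as)`. -/
def GammaAs.d0 : (⟨⟨1⟩⟩ : GammaAs) ⟶ ⟨⟨0⟩⟩ := ⟨FAs.d0, rfl⟩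

/-- `d_1` as a morphism of `Γ(as)`. -/
def GammaAs.d1 : (⟨⟨1⟩⟩ : GammaAs) ⟶ ⟨⟨0⟩⟩ := ⟨FAs.d1, rfl⟩

/-- The `F(as)ᵒᵖ`-module `b`, the cokernel of
`K[Hom(-, [1])] ⟶ K[Hom(-, [0])]`, `Φ ↦ d_0 ∘ Φ - d_1 ∘ Φ`. -/
noncomputable def b (K : Type u) [CommRing K] : FAsᵒᵖ ⥤ ModuleCat.{u} K :=
  Limits.cokernel (linRepMap K FAs.d0 - linRepMap K FAs.d1)

/-- The `Γ(as)ᵒᵖ`-module `b̄`, the cokernel of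
`K[Hom(-, [1])] ⟶ K[Hom(-, [0])]`, `Φ ↦ d_0 ∘ Φ - d_1 ∘ Φ`. -/
noncomputable def bBar (K : Type u) [CommRing K] : GammaAsᵒᵖ ⥤ ModuleCat.{u} K :=
  Limits.cokernel (linRepMap K GammaAs.d0 - linRepMap K GammaAs.d1)

end FunctorTor

open FunctorTor

/-! A morphism `Φ` of F(as) with source [n] is determined by its map of sets and by the total order
on [n] that concatenates its fibres (`lexLE`). Ranking this order writes `Φ` as a nondecreasing map
`a` after a permutation `r`. The permutation need not fix 0, but a rotation corrects this, and
rotations belong to ΔCᵒᵖ: precede `a` by the rotation by `r 0` and follow `r` by its inverse. This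
gives existence in F(as) = ΔCᵒᵖ ⋈ Σ_•. For uniqueness, the order of a morphism of ΔCᵒᵖ is a rotation
of the standard one (`lexLE_toFAs`), so any factorization recovers `r` from its Σ_•-part up to a
rotation, and fixing 0 leaves only one choice. If `Φ` fixes 0, so does its cyclic part, and the
morphisms of ΔCᵒᵖ that fix 0 are those of Δᵒᵖ.

The Tor statement is formal for any B = C ⋈ D. In L_D(M) one has m ⊗ g = (m ⊗ id)g, so in L_D(M) ⊗_B
N the element (m ⊗ g) ⊗ n equals (m ⊗ id) ⊗ N(g)n; this is the pseudo-adjunction (`tensorEquiv`).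
Unique factorization splits the restriction of K[Hom_B(X, -)] to C into a sum of modules K[Hom_C(Y,
-)], so restriction, which is exact because exactness is pointwise, also preserves projectives. A
projective resolution over B therefore restricts to one over C, and both Tor groups are the homology
of the same complex.

For b and b̄: the module L_D(K)(X) has the D-morphisms out of X as a basis. A morphism X → [0] is a
total order on X, and passing to its Σ_•-part identifies the orders that differ by a rotation. The
relation d_0 ∘ Φ ∼ d_1 ∘ Φ interchanges two consecutive blocks of an order, which is a rotation, and
every nontrivial rotation arises in this way. `IsCrossed.nonempty_cokernel_iso` isolates what this
argument needs. -/

namespace FunctorTor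

/-! ### Ranking a finite total order -/

section Rank

lemma exists_equiv_fin_of_total {α : Type*} [Fintype α] {k : ℕ} (hk : Fintype.card α = k)
    (R : α → α → Prop) (refl : ∀ x, R x x) (trans : ∀ x y z, R x y → R y z → R x z)
    (antisymm : ∀ x y, R x y → R y x → x = y) (total : ∀ x y, R x y ∨ R y x) :
    ∃ e : α ≃ Fin k, ∀ x y, e x ≤ e y ↔ R x y := by
  classical
  let : LinearOrder α :=
    { le := R
      le_refl := refl
      le_trans := trans
      le_antisymm := antisymm
      le_total := total
      toDecidableLE := fun _ _ => Classical.dec _ }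
  exact ⟨(monoEquivOfFin α hk).symm.toEquiv, fun x y => (monoEquivOfFin α hk).symm.le_iff_le⟩

/-- A finite chain has no order automorphism except the identity. Every uniqueness statement about
factorizations below rests on this rigidity. -/
lemma equiv_fin_unique {α : Type*} {k : ℕ} {e e' : α ≃ Fin k}
    (h : ∀ x y, e x ≤ e y ↔ e' x ≤ e' y) : e = e' := by
  let o : Fin k ≃o Fin k :=
    { toEquiv := e.symm.trans e'
      map_rel_iff' := by
        intro a b
        simp [← h] }
  have ho : o = OrderIso.refl _ := Subsingleton.elim _ _
  ext x : 1
  have := congrArg (fun t : Fin k ≃o Fin k => t (e x)) ho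
  simpa [o] using this.symm

end Rank

/-! ### Residues and rotations of [n] -/

lemma residue_add_mul (n : ℕ) (i c : ℤ) : residue n (i + c * (n + 1)) = residue n i :=
  ((residue_eq_iff _ _ _).2 ⟨c, rfl⟩).symm

lemma exists_eq_residue_add (n : ℕ) (i : ℤ) :
    ∃ c : ℤ, i = ((residue n i : Fin (n + 1)) : ℕ) + c * (n + 1) :=
  (residue_eq_iff _ _ _).1 (residue_val n (residue n i))

lemma residue_residue_add (n : ℕ) (i j : ℤ) :
    residue n (((residue n i : Fin (n + 1)) : ℕ) + j) = residue n (i + j) := by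
  obtain ⟨c, hc⟩ := exists_eq_residue_add n i
  exact (residue_eq_iff _ _ _).2 ⟨c, by linarith⟩

lemma residue_zero (n : ℕ) : residue n 0 = 0 := residue_val n 0

/-- Translation of residues by `a`. -/
def residueShift (n : ℕ) (a : ℤ) : Equiv.Perm (Fin (n + 1)) where
  toFun x := residue n (x + a)
  invFun x := residue n (x + -a)
  left_inv x := by
    dsimp only
    rw [residue_residue_add, add_neg_cancel_right, residue_val]
  right_inv x := by
    dsimp only
    rw [residue_residue_add, neg_add_cancel_right, residue_val]

lemma residueShift_apply (n : ℕ) (a : ℤ) (x : Fin (n + 1)) :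
    residueShift n a x = residue n (x + a) := rfl

lemma residueShift_residue (n : ℕ) (a i : ℤ) :
    residueShift n a (residue n i) = residue n (i + a) := residue_residue_add n i a

/-! ### Morphisms of F(as) through their concatenated order -/

namespace FAs

variable {X Y Z : FAs}

lemma ext_fibreLE {f g : X ⟶ Y} (h1 : ∀ x, f.toFun x = g.toFun x)
    (h2 : ∀ x y, f.fibreLE x y ↔ g.fibreLE x y) : f = g :=
  FAs.hom_ext (funext h1) (funext fun x => funext fun y => propext (h2 x y))

/-- The total order on the source of a morphism of `F(as)` that concatenates the fibres. -/
def lexLE (Φ : X ⟶ Y) (x y : Fin (X.len + 1)) : Prop :=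
  Φ.toFun x < Φ.toFun y ∨ Φ.fibreLE x y

lemma lexLE_refl (Φ : X ⟶ Y) (x) : lexLE Φ x x := Or.inr (Φ.refl x)

lemma lexLE_trans (Φ : X ⟶ Y) (x y z) (h : lexLE Φ x y) (h' : lexLE Φ y z) : lexLE Φ x z := by
  rcases h with h | h <;> rcases h' with h' | h'
  · exact Or.inl (h.trans h')
  · exact Or.inl (h.trans_eq (Φ.map_eq h'))
  · exact Or.inl ((Φ.map_eq h).trans_lt h')
  · exact Or.inr (Φ.trans h h')

lemma lexLE_antisymm (Φ : X ⟶ Y) (x y) (h : lexLE Φ x y) (h' : lexLE Φ y x) : x = y := by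
  rcases h with h | h <;> rcases h' with h' | h'
  · exact absurd h' h.asymm
  · exact absurd (Φ.map_eq h') h.ne'
  · exact absurd (Φ.map_eq h) h'.ne'
  · exact Φ.antisymm h h'

lemma lexLE_total (Φ : X ⟶ Y) (x y) : lexLE Φ x y ∨ lexLE Φ y x := by
  rcases lt_trichotomy (Φ.toFun x) (Φ.toFun y) with h | h | h
  · exact Or.inl (Or.inl h)
  · exact (Φ.total h).imp Or.inr Or.inr
  · exact Or.inr (Or.inl h)

lemma fibreLE_iff (Φ : X ⟶ Y) (x y) : Φ.fibreLE x y ↔ Φ.toFun x = Φ.toFun y ∧ lexLE Φ x y :=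
  ⟨fun h => ⟨Φ.map_eq h, Or.inr h⟩, fun h => h.2.resolve_left h.1.not_lt⟩

/-- The fibre orders are the restrictions of the concatenated order to the fibres, so nothing is
lost by replacing them with a single total order. -/
lemma ext_lexLE {f g : X ⟶ Y} (h1 : ∀ x, f.toFun x = g.toFun x)
    (h2 : ∀ x y, lexLE f x y ↔ lexLE g x y) : f = g :=
  ext_fibreLE h1 fun x y => by rw [fibreLE_iff, fibreLE_iff, h1, h1, h2]

lemma toFun_mono (Φ : X ⟶ Y) {x y} (h : lexLE Φ x y) : Φ.toFun x ≤ Φ.toFun y :=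
  h.elim le_of_lt fun h => (Φ.map_eq h).le

lemma fibreLE_of_injective {f : X ⟶ Y} (hf : Function.Injective f.toFun) (x y) :
    f.fibreLE x y ↔ x = y :=
  ⟨fun h => hf (f.map_eq h), fun h => h ▸ f.refl x⟩

lemma comp_fibreLE_of_injective {f : X ⟶ Y} (hf : Function.Injective f.toFun) (g : Y ⟶ Z) (x y) :
    (f ≫ g).fibreLE x y ↔ g.fibreLE (f.toFun x) (f.toFun y) :=
  ⟨fun h => h.1, fun h => ⟨h, fun e => hf e ▸ f.refl x⟩⟩

lemma comp_lexLE_of_injective {f : X ⟶ Y} (hf : Function.Injective f.toFun) (g : Y ⟶ Z) (x y) :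
    lexLE (f ≫ g) x y ↔ lexLE g (f.toFun x) (f.toFun y) :=
  or_congr Iff.rfl (comp_fibreLE_of_injective hf g x y)

lemma ext_of_injective {f g : X ⟶ Y} (hf : Function.Injective f.toFun)
    (h : ∀ x, f.toFun x = g.toFun x) : f = g := by
  refine ext_fibreLE h fun x y => ?_
  rw [fibreLE_of_injective hf, fibreLE_of_injective (funext h ▸ hf : Function.Injective g.toFun)]

lemma comp_left_cancel {f : X ⟶ Y} (hf : Function.Bijective f.toFun) {g g' : Y ⟶ Z}
    (h : f ≫ g = f ≫ g') : g = g' := by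
  refine ext_fibreLE (fun x => ?_) fun x y => ?_
  · obtain ⟨x, rfl⟩ := hf.2 x
    exact congrArg (fun t : X ⟶ Z => t.toFun x) h
  · obtain ⟨x, rfl⟩ := hf.2 x
    obtain ⟨y, rfl⟩ := hf.2 y
    rw [← comp_fibreLE_of_injective hf.1, h, comp_fibreLE_of_injective hf.1]

lemma len_eq_of_bijective {f : X ⟶ Y} (hf : Function.Bijective f.toFun) : X.len = Y.len := by
  simpa using Fintype.card_of_bijective hf

/-- The morphism of `F(as)` given by a permutation. -/
def ofPerm {n : ℕ} (e : Equiv.Perm (Fin (n + 1))) : (⟨n⟩ : FAs) ⟶ ⟨n⟩ :=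
  FAs.Hom.mk (X := ⟨n⟩) (Y := ⟨n⟩) e Eq (congrArg e) (fun _ => rfl) Eq.trans (fun h _ => h)
    (fun h => Or.inl (e.injective h))

lemma exists_rank {n : ℕ} {Y : FAs} (Φ : (⟨n⟩ : FAs) ⟶ Y) :
    ∃ r : Equiv.Perm (Fin (n + 1)), ∀ x y, r x ≤ r y ↔ lexLE Φ x y :=
  exists_equiv_fin_of_total (by simp) _ (lexLE_refl Φ) (lexLE_trans Φ) (lexLE_antisymm Φ)
    (lexLE_total Φ)

end FAs

/-! ### The orders defined by periodic maps, and faithfulness of the inclusion of ΔCᵒᵖ -/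

namespace PeriodicMap

variable {n m : ℕ}

/-- `φ.adj.toFun 0` is the first integer with a nonnegative value. A value of at least `m + 1` in
the window of length `n + 1` starting there would, one period earlier, be a nonnegative value before
the first one. -/
lemma map_nonneg_and_le (φ : PeriodicMap n m) (k : Fin (n + 1)) :
    0 ≤ φ.toFun (φ.adj.toFun 0 + (k : ℕ)) ∧ φ.toFun (φ.adj.toFun 0 + (k : ℕ)) < m + 1 := by
  constructor
  · rw [← φ.adj_le_iff]
    omega
  · by_contra! h
    have h1 := φ.map_add_mul (φ.adj.toFun 0 + (k : ℕ)) (-1)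
    have h2 := (φ.adj_le_iff (φ.adj.toFun 0 + (k : ℕ) + -1 * (n + 1)) 0).2 (by linarith)
    omega

lemma residue_le_residue_iff {m : ℕ} {p q : ℤ} (hp : 0 ≤ p ∧ p < m + 1)
    (hq : 0 ≤ q ∧ q < m + 1) : residue m p ≤ residue m q ↔ p ≤ q := by
  have h1 := residue_coe m p
  have h2 := residue_coe m q
  rw [Int.emod_eq_of_lt hp.1 hp.2] at h1
  rw [Int.emod_eq_of_lt hq.1 hq.2] at h2
  rw [Fin.le_def]
  omega

/-- On the window starting at `φ.adj.toFun 0` the values lie in {0, …, m}, so they are their own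
residues. Reading the window from left to right thus lists the fibres over 0, …, m one after the
other, each in its own order. -/
lemma lexLE_of_le (φ : PeriodicMap n m) {k l : Fin (n + 1)} (h : k ≤ l) :
    FAs.lexLE φ.toFAs (residue n (φ.adj.toFun 0 + (k : ℕ)))
      (residue n (φ.adj.toFun 0 + (l : ℕ))) := by
  have h' : φ.adj.toFun 0 + (k : ℕ) ≤ φ.adj.toFun 0 + (l : ℕ) := by
    have := Fin.le_def.1 h
    omega
  rcases (φ.monotone h').eq_or_lt with e | e
  · exact Or.inr ⟨_, _, rfl, rfl, h', e⟩
  · left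
    rw [φ.toFAs_toFun, φ.toFAs_toFun]
    rw [← not_le] at e ⊢
    rwa [residue_le_residue_iff (φ.map_nonneg_and_le l) (φ.map_nonneg_and_le k)]

/-- The total order defined by a periodic map is a rotation of the standard one. -/
lemma lexLE_toFAs (φ : PeriodicMap n m) (x y : Fin (n + 1)) :
    residueShift n (-φ.adj.toFun 0) x ≤ residueShift n (-φ.adj.toFun 0) y ↔
      FAs.lexLE φ.toFAs x y := by
  have key : ∀ z, z = residue n (φ.adj.toFun 0 + (residueShift n (-φ.adj.toFun 0) z : ℕ)) := by
    intro z
    rw [add_comm (φ.adj.toFun 0), residueShift_apply, residue_residue_add, neg_add_cancel_right,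
      residue_val]
  have aux : ∀ x y, residueShift n (-φ.adj.toFun 0) x ≤ residueShift n (-φ.adj.toFun 0) y →
      FAs.lexLE φ.toFAs x y := by
    intro x y h
    have := φ.lexLE_of_le h
    rwa [← key, ← key] at this
  -- Both relations are total orders, so one inclusion between them gives the other by antisymmetry.
  refine ⟨aux x y, fun h => ?_⟩
  by_contra! h'
  exact h'.ne (congrArg _ (FAs.lexLE_antisymm _ _ _ h (aux y x h'.le)).symm)

/-- Equal orders mean equal rotations, so the two windows start at integers that agree modulo `n +
1`. On the windows the values are read off from their residues, and periodicity turns the offset `c`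
of the windows into the offset `c * (m + 1)` of the values. -/
lemma equiv_of_toFAs_eq {φ φ' : PeriodicMap n m} (h : φ.toFAs = φ'.toFAs) : φ ≈ φ' := by
  have hr : residueShift n (-φ.adj.toFun 0) = residueShift n (-φ'.adj.toFun 0) :=
    equiv_fin_unique fun x y => by rw [lexLE_toFAs, lexLE_toFAs, h]
  have ha := congrArg (fun e : Equiv.Perm (Fin (n + 1)) => e 0) hr
  simp only [residueShift_apply, Fin.val_zero, Nat.cast_zero, zero_add] at ha
  obtain ⟨c, hc⟩ := (residue_eq_iff _ _ _).1 ha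
  have hc' : φ.adj.toFun 0 = φ'.adj.toFun 0 + c * (n + 1) := by linarith
  refine ⟨c, fun i => ?_⟩
  have key : ∀ k : Fin (n + 1), φ.toFun (φ.adj.toFun 0 + (k : ℕ)) =
      φ'.toFun (φ'.adj.toFun 0 + (k : ℕ)) := by
    intro k
    have e : φ.toFAs.toFun (residue n (φ.adj.toFun 0 + (k : ℕ))) =
        φ'.toFAs.toFun (residue n (φ'.adj.toFun 0 + (k : ℕ))) := by
      rw [h]
      refine congrArg φ'.toFAs.toFun ((residue_eq_iff _ _ _).2 ⟨-c, ?_⟩)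
      linarith
    rw [φ.toFAs_toFun, φ'.toFAs_toFun] at e
    exact le_antisymm
      ((residue_le_residue_iff (φ.map_nonneg_and_le k) (φ'.map_nonneg_and_le k)).1 e.le)
      ((residue_le_residue_iff (φ'.map_nonneg_and_le k) (φ.map_nonneg_and_le k)).1 e.ge)
  obtain ⟨d, hd⟩ := exists_eq_residue_add n (i - φ.adj.toFun 0)
  have e1 := φ.map_add_mul (φ.adj.toFun 0 + (residue n (i - φ.adj.toFun 0) : ℕ)) d
  have e2 := φ'.map_add_mul (φ'.adj.toFun 0 + (residue n (i - φ.adj.toFun 0) : ℕ)) (d + c)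
  rw [show φ.adj.toFun 0 + (residue n (i - φ.adj.toFun 0) : ℕ) + d * ((n : ℤ) + 1) = i by
    linarith, key] at e1
  rw [show φ'.adj.toFun 0 + (residue n (i - φ.adj.toFun 0) : ℕ) + (d + c) * ((n : ℤ) + 1) = i by
    linarith] at e2
  linarith

/-- The map `i ↦ -f (-i)`. -/
def neg (f : PeriodicMap n m) : PeriodicMap n m where
  toFun i := -f.toFun (-i)
  monotone i j h := neg_le_neg (f.monotone (neg_le_neg h))
  map_add_period i := by
    have := f.map_add_mul (-i) (-1)
    rw [show -(i + ((n : ℤ) + 1)) = -i + -1 * (n + 1) by ring, this]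
    ring

lemma le_neg_adj_neg_iff (f : PeriodicMap n m) (i j : ℤ) :
    i ≤ f.neg.adj.neg.toFun j ↔ f.toFun i ≤ j := by
  change i ≤ -(f.neg.adj.toFun (-j)) ↔ _
  rw [le_neg, adj_le_iff]
  change -j ≤ -f.toFun (- -i) ↔ _
  rw [neg_neg, neg_le_neg_iff]

/-- Conjugation by negation exchanges left and right adjoints, so `f.neg.adj.neg` is the right
adjoint of `f`. Every periodic map is therefore a left adjoint, which gives the surjectivity in
`exists_cyclicInclusion_map_eq`. -/
lemma adj_neg_adj_neg (f : PeriodicMap n m) : f.neg.adj.neg.adj = f := by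
  ext i
  refine eq_of_forall_ge_iff fun j => ?_
  rw [adj_le_iff, le_neg_adj_neg_iff]

lemma equiv_of_adj_equiv {f g : PeriodicMap n m} (h : f.adj ≈ g.adj) : f ≈ g := by
  obtain ⟨c, hc⟩ := h
  refine ⟨-c, fun i => eq_of_forall_le_iff fun j => ?_⟩
  rw [← g.adj_le_iff, hc, ← le_sub_iff_add_le, f.adj_le_iff, sub_eq_add_neg, ← neg_mul,
    f.map_add_mul]

/-- The translation by `c`. -/
def translation (n : ℕ) (c : ℤ) : PeriodicMap n n :=
  ⟨fun i => i + c, fun _ _ h => by dsimp only; linarith, fun i => by ring⟩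

end PeriodicMap

instance : cyclicInclusion.Faithful where
  map_injective {X Y} f g h := by
    obtain ⟨f⟩ := f
    obtain ⟨g⟩ := g
    induction f using Quotient.inductionOn with | _ f
    induction g using Quotient.inductionOn with | _ g
    exact Quiver.Hom.unop_inj (Quotient.sound
      (PeriodicMap.equiv_of_adj_equiv (PeriodicMap.equiv_of_toFAs_eq h)))

lemma cyclicInclusion_map_mk {n m : ℕ} (g : PeriodicMap m n) :
    cyclicInclusion.map (Quiver.Hom.op (⟦g⟧ : (⟨m⟩ : CyclicCat) ⟶ ⟨n⟩)) = g.adj.toFAs := rfl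

/-- The periodic maps give all the morphisms of `ΔCᵒᵖ`. -/
lemma exists_cyclicInclusion_map_eq {n m : ℕ} (φ : PeriodicMap n m) :
    ∃ Ψ : op (⟨n⟩ : CyclicCat) ⟶ op ⟨m⟩, cyclicInclusion.map Ψ = φ.toFAs := by
  refine ⟨Quiver.Hom.op (⟦φ.neg.adj.neg⟧ : (⟨m⟩ : CyclicCat) ⟶ ⟨n⟩), ?_⟩
  rw [cyclicInclusion_map_mk, PeriodicMap.adj_neg_adj_neg]

lemma exists_toFAs_eq {n m : ℕ} (Ψ : op (⟨n⟩ : CyclicCat) ⟶ op ⟨m⟩) :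
    ∃ φ : PeriodicMap n m, cyclicInclusion.map Ψ = φ.toFAs := by
  obtain ⟨g⟩ := Ψ
  induction g using Quotient.inductionOn with | _ g
  exact ⟨g.adj, rfl⟩

/-! ### The crossed factorizations of F(as) and Γ(as) -/

namespace FAs

/-- With `r` the rank for the concatenated order, `Φ` is nondecreasing in terms of ranks. Shifting
ranks by `-r 0` makes the permutation fix 0, and the translation by `r 0` inside `φ` undoes the
shift. -/
lemma exists_factor {n m : ℕ} (Φ : (⟨n⟩ : FAs) ⟶ ⟨m⟩) :
    ∃ (φ : PeriodicMap n m) (f : (⟨n⟩ : FAs) ⟶ ⟨n⟩), FAs.sigma f ∧ f ≫ φ.toFAs = Φ := by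
  obtain ⟨r, hr⟩ := exists_rank Φ
  let a : Fin (n + 1) →o Fin (m + 1) :=
    ⟨fun k => Φ.toFun (r.symm k), fun k l h => toFun_mono Φ ((hr _ _).1 (by simpa using h))⟩
  let φ : PeriodicMap n m := (PeriodicMap.translation n (r 0 : ℕ)).comp (periodicExtension a)
  let f : (⟨n⟩ : FAs) ⟶ ⟨n⟩ := ofPerm (r.trans (residueShift n (-(r 0 : ℕ))))
  have hf : Function.Bijective f.toFun := (r.trans (residueShift n (-(r 0 : ℕ)))).bijective
  have hf' : ∀ x, f.toFun x = residue n ((r x : ℕ) + -(r 0 : ℕ)) := fun x => rfl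
  refine ⟨φ, f, ⟨hf, ?_⟩, ext_lexLE (fun x => ?_) fun x y => ?_⟩
  · refine (hf' 0).trans ?_
    rw [add_neg_cancel]
    exact residue_zero n
  · change φ.toFAs.toFun (f.toFun x) = _
    rw [hf']
    refine (φ.toFAs_toFun _).trans ?_
    change residue m ((periodicExtension a).toFun ((r x : ℕ) + -(r 0 : ℕ) + (r 0 : ℕ))) = _
    rw [neg_add_cancel_right, periodicExtension_residue, residue_val]
    change Φ.toFun (r.symm (r x)) = _
    rw [Equiv.symm_apply_apply]
  -- The extension of `a` preserves the sign of its argument, so the values of `φ` become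
  -- nonnegative exactly at `-r 0`. Hence the order of `φ`, pulled back along `f`, is the order
  -- given by the ranks `r`.
  · have ha : φ.adj.toFun 0 = -(r 0 : ℕ) := by
      refine eq_of_forall_ge_iff fun i => ?_
      rw [φ.adj_le_iff]
      change 0 ≤ (periodicExtension a).toFun (i + (r 0 : ℕ)) ↔ _
      rw [← Int.ediv_nonneg_iff_of_pos (show (0 : ℤ) < m + 1 by omega), periodicExtension_ediv,
        Int.ediv_nonneg_iff_of_pos (by omega), neg_le_iff_add_nonneg]
    have hs : ∀ x, residueShift n (-φ.adj.toFun 0) (f.toFun x) = r x := by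
      intro x
      rw [hf', ha]
      refine (residueShift_residue _ _ _).trans ?_
      rw [neg_neg, neg_add_cancel_right, residue_val]
    rw [comp_lexLE_of_injective hf.1, ← PeriodicMap.lexLE_toFAs, hs, hs, hr]

/-- The rank of the composite is `f` followed by a rotation that depends only on `φ`. Since `f` and
`f'` both fix 0, comparing the ranks of 0 shows that the two rotations agree. -/
lemma factor_unique {n m : ℕ} {φ φ' : PeriodicMap n m} {f f' : (⟨n⟩ : FAs) ⟶ ⟨n⟩}
    (hf : FAs.sigma f) (hf' : FAs.sigma f') (h : f ≫ φ.toFAs = f' ≫ φ'.toFAs) : f = f' := by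
  let e := (Equiv.ofBijective _ hf.1).trans (residueShift n (-φ.adj.toFun 0))
  let e' := (Equiv.ofBijective _ hf'.1).trans (residueShift n (-φ'.adj.toFun 0))
  have he : e = e' := equiv_fin_unique fun x y => by
    change residueShift n (-φ.adj.toFun 0) (f.toFun x) ≤
        residueShift n (-φ.adj.toFun 0) (f.toFun y) ↔
      residueShift n (-φ'.adj.toFun 0) (f'.toFun x) ≤ residueShift n (-φ'.adj.toFun 0) (f'.toFun y)
    rw [φ.lexLE_toFAs, φ'.lexLE_toFAs, ← comp_lexLE_of_injective hf.1.1,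
      ← comp_lexLE_of_injective hf'.1.1, h]
  have hx : ∀ x, residueShift n (-φ.adj.toFun 0) (f.toFun x) =
      residueShift n (-φ'.adj.toFun 0) (f'.toFun x) := fun x =>
    congrArg (fun t : Fin (n + 1) ≃ Fin (n + 1) => t x) he
  have h0 := hx 0
  rw [show f.toFun 0 = 0 from hf.2, show f'.toFun 0 = 0 from hf'.2] at h0
  simp only [residueShift_apply, Fin.val_zero, Nat.cast_zero, zero_add] at h0
  obtain ⟨c, hc⟩ := (residue_eq_iff _ _ _).1 h0
  refine ext_of_injective hf.1.1 fun x => (residueShift n (-φ.adj.toFun 0)).injective ?_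
  rw [hx, residueShift_apply, residueShift_apply]
  exact (residue_eq_iff _ _ _).2 ⟨-c, by rw [hc]; ring⟩

instance : FAs.sigma.IsMultiplicative where
  id_mem _ := ⟨Function.bijective_id, rfl⟩
  comp_mem _ g hf hg := ⟨hg.1.comp hf.1, (congrArg g.toFun hf.2).trans hg.2⟩

end FAs

instance : GammaAs.sigma.IsMultiplicative where
  id_mem _ := Function.bijective_id
  comp_mem _ _ hf hg := hg.comp hf

/-- `F(as) = ΔCᵒᵖ ⋈ Σ_•`. -/
theorem isCrossed_cyclicInclusion : IsCrossed cyclicInclusion FAs.sigma where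
  faithful := inferInstance
  bijective_obj := ⟨fun X Y h => by
    obtain ⟨⟨n⟩⟩ := X
    obtain ⟨⟨m⟩⟩ := Y
    cases h
    rfl, fun X => ⟨op ⟨X.len⟩, rfl⟩⟩
  multiplicative := inferInstance
  existsUnique_factor := by
    rintro ⟨n⟩ ⟨⟨m⟩⟩ Φ
    obtain ⟨φ, f, hf, h⟩ := FAs.exists_factor Φ
    obtain ⟨Ψ, hΨ⟩ := exists_cyclicInclusion_map_eq φ
    refine ⟨⟨op ⟨n⟩, Ψ, f, hf⟩, (congrArg (f ≫ ·) hΨ).trans h, ?_⟩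
    rintro ⟨⟨⟨n'⟩⟩, Ψ', f', hf'⟩ h'
    -- A bijection forces the intermediate object to be [n] itself; after `f' = f`, bijectivity also
    -- allows it to be cancelled.
    obtain rfl : n = n' := FAs.len_eq_of_bijective hf'.1
    obtain ⟨φ', hφ'⟩ := exists_toFAs_eq Ψ'
    have h2 : f' ≫ φ'.toFAs = f ≫ φ.toFAs := by
      rw [← hφ', h]
      exact h'
    obtain rfl : f' = f := FAs.factor_unique hf' hf h2
    obtain rfl : Ψ' = Ψ := cyclicInclusion.map_injective (by
      rw [hφ', hΨ]
      exact FAs.comp_left_cancel hf.1 h2)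
    rfl

/-- A morphism of `ΔC` belongs to `Δ` if its image in `F(as)` fixes `0`. -/
lemma exists_simplexToCyclic_map_eq {n m : ℕ} (g : (⟨n⟩ : CyclicCat) ⟶ ⟨m⟩)
    (hg : FAs.pointed (cyclicInclusion.map g.op)) :
    ∃ a : SimplexCategory.mk n ⟶ SimplexCategory.mk m, simplexToCyclic.map a = g := by
  induction g using Quotient.inductionOn with | _ g
  have h0 : residue n 0 = residue n (g.adj.toFun 0) := by
    rw [residue_zero]
    exact Eq.symm hg
  -- The window of `g` starts at the multiple `c * (n + 1)` of the period. So the representative `g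
  -- + c * (m + 1)` maps {0, …, n} into {0, …, m}, and it is the periodic extension of its
  -- restriction there.
  obtain ⟨c, hc⟩ := (residue_eq_iff _ _ _).1 h0
  have hb : ∀ k : Fin (n + 1), 0 ≤ g.toFun (k : ℕ) + c * (m + 1) ∧
      g.toFun (k : ℕ) + c * (m + 1) < m + 1 := by
    intro k
    have := g.map_nonneg_and_le k
    rwa [hc, zero_add, add_comm, g.map_add_mul] at this
  have hr : ∀ k : Fin (n + 1), ((residue m (g.toFun (k : ℕ)) : ℕ) : ℤ) =
      g.toFun (k : ℕ) + c * (m + 1) := by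
    intro k
    rw [← residue_add_mul m _ c, residue_coe, Int.emod_eq_of_lt (hb k).1 (hb k).2]
  let a : Fin (n + 1) →o Fin (m + 1) :=
    ⟨fun k => residue m (g.toFun (k : ℕ)), fun k l h => by
      have h1 := g.monotone (Int.ofNat_le.2 (Fin.le_def.1 h))
      rw [Fin.le_def, ← Int.ofNat_le]
      change ((residue m (g.toFun (k : ℕ)) : ℕ) : ℤ) ≤ ((residue m (g.toFun (l : ℕ)) : ℕ) : ℤ)
      rw [hr, hr]
      simpa using h1⟩
  refine ⟨SimplexCategory.mkHom a, Quotient.sound ⟨-c, fun i => ?_⟩⟩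
  change g.toFun i = ((residue m (g.toFun (residue n i : ℕ)) : ℕ) : ℤ) +
    (i / (n + 1)) * (m + 1) + -c * (m + 1)
  have h1 := g.map_add_mul (residue n i : ℕ) (i / (n + 1))
  rw [residue_coe, mul_comm _ ((n : ℤ) + 1), Int.emod_add_mul_ediv] at h1
  rw [hr, residue_coe, h1]
  ring

instance : simplexToCyclic.Faithful where
  map_injective {X Y} f g h := by
    obtain ⟨c, hc⟩ := Quotient.exact h
    change ∀ i, (periodicExtension g.toOrderHom).toFun i =
      (periodicExtension f.toOrderHom).toFun i + c * (Y.len + 1) at hc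
    ext x : 3
    have := congrArg (residue Y.len) (hc (x : ℕ))
    rw [residue_add_mul, periodicExtension_residue, periodicExtension_residue, residue_val] at this
    exact this.symm

instance : simplicialInclusion.Faithful where
  map_injective {X Y} _ _ h :=
    (simplexToCyclic.op ⋙ cyclicInclusion).map_injective
      (congrArg (fun t : simplicialInclusion.obj X ⟶ simplicialInclusion.obj Y => t.hom) h)

/-- `Γ(as) = Δᵒᵖ ⋈ Σ_•`. -/
theorem isCrossed_simplicialInclusion : IsCrossed simplicialInclusion GammaAs.sigma where
  faithful := inferInstance
  bijective_obj := ⟨fun X Y h => by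
    obtain ⟨X⟩ := X
    obtain ⟨Y⟩ := Y
    refine congrArg op (SimplexCategory.ext ?_)
    exact congrArg (fun t : GammaAs => t.obj.len) h,
    fun X => ⟨op (SimplexCategory.mk X.obj.len), rfl⟩⟩
  multiplicative := inferInstance
  existsUnique_factor := by
    rintro ⟨⟨n⟩⟩ ⟨⟨m⟩⟩ Φ
    obtain ⟨φ, f, hf, h⟩ := FAs.exists_factor Φ.hom
    obtain ⟨Ψ, hΨ⟩ := exists_cyclicInclusion_map_eq φ
    -- Both `Φ` and `f` fix 0, hence so does the cyclic part.
    have hp : FAs.pointed (cyclicInclusion.map Ψ) := by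
      have h0 := Φ.property
      rw [← h, ← hΨ] at h0
      have h1 : (cyclicInclusion.map Ψ).toFun (f.toFun 0) = 0 := h0
      rwa [show f.toFun 0 = 0 from hf.2] at h1
    obtain ⟨a, ha⟩ := exists_simplexToCyclic_map_eq Ψ.unop hp
    refine ⟨⟨op (SimplexCategory.mk n), a.op, ⟨f, hf.2⟩, hf.1⟩, ?_, ?_⟩
    · refine WideSubcategory.hom_ext _ ?_
      change f ≫ cyclicInclusion.map (simplexToCyclic.map a).op = Φ.hom
      rw [ha, ← h, ← hΨ]
      rfl
    rintro ⟨⟨⟨n'⟩⟩, a', f', hf'⟩ h'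
    obtain rfl : n = n' := FAs.len_eq_of_bijective hf'
    obtain ⟨φ', hφ'⟩ := exists_toFAs_eq (simplexToCyclic.op.map a')
    have h2 : f'.hom ≫ φ'.toFAs = f ≫ φ.toFAs := by
      rw [← hφ', h, ← h']
      rfl
    obtain rfl : f' = ⟨f, hf.2⟩ :=
      WideSubcategory.hom_ext _ (FAs.factor_unique ⟨hf', f'.property⟩ hf h2)
    obtain rfl : a' = a.op := by
      refine simplexToCyclic.op.map_injective (cyclicInclusion.map_injective ?_)
      refine hφ'.trans ((FAs.comp_left_cancel hf.1 h2).trans (hΨ.symm.trans ?_))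
      exact congrArg (fun t => cyclicInclusion.map (Quiver.Hom.op t)) ha.symm
    rfl

/-! ### Generators and the universal property of the tensor product over a category -/

section TensorGenerators

variable {K : Type u} [CommRing K] {B : Type} [SmallCategory B]

open scoped Classical in
/-- The class of `m ⊗ n` in `M ⊗_B N`, for `m ∈ M(X)` and `n ∈ N(X)`. -/
noncomputable def tensorMk (M : Bᵒᵖ ⥤ ModuleCat.{u} K) (N : B ⥤ ModuleCat.{u} K) (X : B) :
    M.obj (op X) →ₗ[K] N.obj X →ₗ[K] (tensor.obj M).obj N :=
  (TensorProduct.mk K _ _).compr₂ ((tensorRel M N).mkQ ∘ₗ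
    DirectSum.lof K B (fun X => M.obj (op X) ⊗[K] N.obj X) X)

variable {M M' : Bᵒᵖ ⥤ ModuleCat.{u} K} {N N' : B ⥤ ModuleCat.{u} K}

lemma tensorMk_map {X Y : B} (Φ : X ⟶ Y) (m : M.obj (op Y)) (n : N.obj X) :
    tensorMk M N X ((M.map Φ.op).hom m) n = tensorMk M N Y m ((N.map Φ).hom n) := by
  classical
  exact (Submodule.Quotient.eq _).2 (Submodule.subset_span ⟨X, Y, Φ, m, n, rfl⟩)

lemma tensor_hom_ext {V : Type*} [AddCommGroup V] [Module K V]
    {a b : ((tensor.obj M).obj N : Type u) →ₗ[K] V}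
    (h : ∀ X m n, a (tensorMk M N X m n) = b (tensorMk M N X m n)) : a = b := by
  classical
  exact Submodule.linearMap_qext _ (DirectSum.linearMap_ext _ fun X =>
    TensorProduct.ext' fun m n => h X m n)

open scoped Classical in
/-- The linear map out of `M ⊗_B N` defined by a balanced family of bilinear maps. -/
noncomputable def tensorDesc {V : Type*} [AddCommGroup V] [Module K V]
    (f : ∀ X, M.obj (op X) →ₗ[K] N.obj X →ₗ[K] V)
    (hf : ∀ {X Y : B} (Φ : X ⟶ Y) (m : M.obj (op Y)) (n : N.obj X),
      f X ((M.map Φ.op).hom m) n = f Y m ((N.map Φ).hom n)) :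
    ((tensor.obj M).obj N : Type u) →ₗ[K] V :=
  (tensorRel M N).liftQ (DirectSum.toModule K B V fun X => TensorProduct.lift (f X)) (by
    rw [tensorRel, Submodule.span_le]
    rintro _ ⟨X, Y, Φ, m, n, rfl⟩
    rw [SetLike.mem_coe, LinearMap.mem_ker, map_sub, DirectSum.toModule_lof,
      DirectSum.toModule_lof, TensorProduct.lift.tmul, TensorProduct.lift.tmul, hf, sub_self])

lemma tensorDesc_mk {V : Type*} [AddCommGroup V] [Module K V]
    (f : ∀ X, M.obj (op X) →ₗ[K] N.obj X →ₗ[K] V)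
    (hf : ∀ {X Y : B} (Φ : X ⟶ Y) (m : M.obj (op Y)) (n : N.obj X),
      f X ((M.map Φ.op).hom m) n = f Y m ((N.map Φ).hom n)) (X m n) :
    tensorDesc f hf (tensorMk M N X m n) = f X m n := by
  classical
  change DirectSum.toModule K B V (fun X => TensorProduct.lift (f X))
    (DirectSum.lof K B (fun X => M.obj (op X) ⊗[K] N.obj X) X (m ⊗ₜ n)) = _
  rw [DirectSum.toModule_lof, TensorProduct.lift.tmul]

lemma tensor_map_app_mk (a : M ⟶ M') (X m n) :
    ((tensor.map a).app N).hom (tensorMk M N X m n) =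
      tensorMk M' N X ((a.app (op X)).hom m) n := by
  classical
  change (tensorRel M' N).mkQ (preTensorMap a (𝟙 N) (DirectSum.lof K B _ X (m ⊗ₜ n))) = _
  rw [preTensorMap, DirectSum.lmap_lof, TensorProduct.map_tmul]
  rfl

lemma tensor_obj_map_mk (b : N ⟶ N') (X m n) :
    ((tensor.obj M).map b).hom (tensorMk M N X m n) =
      tensorMk M N' X m ((b.app X).hom n) := by
  classical
  change (tensorRel M N').mkQ (preTensorMap (𝟙 M) b (DirectSum.lof K B _ X (m ⊗ₜ n))) = _
  rw [preTensorMap, DirectSum.lmap_lof, TensorProduct.map_tmul]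
  rfl

end TensorGenerators

/-! ### Pseudo-free modules and the pseudo-adjunction -/

section PseudoFree

variable {K : Type u} [CommRing K] {B C : Type} [SmallCategory B] [SmallCategory C]
  {ι : C ⥤ B} {D : MorphismProperty B} {M M' : Cᵒᵖ ⥤ ModuleCat.{u} K}

open scoped Classical in
/-- The map `m ↦ m ⊗ g` into `⨁_A M(A) ⊗ K[Hom_D(X, A)]`. -/
noncomputable def pseudoFreeMk (M : Cᵒᵖ ⥤ ModuleCat.{u} K) {X : B} {A : C}
    (g : {g : X ⟶ ι.obj A // D g}) : M.obj (op A) →ₗ[K] PseudoFreeObj ι D M X :=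
  DirectSum.lof K C (fun A => M.obj (op A) ⊗[K] ({g : X ⟶ ι.obj A // D g} →₀ K)) A ∘ₗ
    (TensorProduct.mk K _ _).flip (Finsupp.single g 1)

open scoped Classical in
/-- The linear map out of `⨁_A M(A) ⊗ K[Hom_D(X, A)]` defined by its values on the `m ⊗ g`. -/
noncomputable def pseudoFreeDesc {V : Type*} [AddCommGroup V] [Module K V] {X : B}
    (f : ∀ A, {g : X ⟶ ι.obj A // D g} → M.obj (op A) →ₗ[K] V) :
    PseudoFreeObj ι D M X →ₗ[K] V :=
  DirectSum.toModule K C V fun A => TensorProduct.lift (Finsupp.linearCombination K (f A)).flip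

lemma pseudoFreeDesc_mk {V : Type*} [AddCommGroup V] [Module K V] {X : B}
    (f : ∀ A, {g : X ⟶ ι.obj A // D g} → M.obj (op A) →ₗ[K] V) {A : C}
    (g : {g : X ⟶ ι.obj A // D g}) (m : M.obj (op A)) :
    pseudoFreeDesc f (pseudoFreeMk M g m) = f A g m := by
  classical
  simp [pseudoFreeDesc, pseudoFreeMk]

lemma pseudoFree_map_mk (h : IsCrossed ι D) {X Y : B} (Φ : X ⟶ Y) {A : C}
    (g : {g : Y ⟶ ι.obj A // D g}) (m : M.obj (op A)) :
    (((h.pseudoFree K).obj M).map Φ.op).hom (pseudoFreeMk M g m) =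
      pseudoFreeMk M (h.factor (Φ ≫ g.1)).2.2 ((M.map (h.factor (Φ ≫ g.1)).2.1.op).hom m) :=
  h.pseudoFreeAct_lof M Φ m g

lemma pseudoFree_map_mk_of_eq (h : IsCrossed ι D) {X Y : B} (Φ : X ⟶ Y) {A A' : C}
    (g : {g : Y ⟶ ι.obj A // D g}) (m : M.obj (op A)) (g' : {g : X ⟶ ι.obj A' // D g})
    (Ψ : A' ⟶ A) (e : g'.1 ≫ ι.map Ψ = Φ ≫ g.1) :
    (((h.pseudoFree K).obj M).map Φ.op).hom (pseudoFreeMk M g m) =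
      pseudoFreeMk M g' ((M.map Ψ.op).hom m) := by
  rw [pseudoFree_map_mk, h.factor_eq (Φ ≫ g.1) ⟨A', Ψ, g'⟩ e]

lemma pseudoFree_map_app_mk (h : IsCrossed ι D) (a : M ⟶ M') {X : B} {A : C}
    (g : {g : X ⟶ ι.obj A // D g}) (m : M.obj (op A)) :
    (((h.pseudoFree K).map a).app (op X)).hom (pseudoFreeMk M g m) =
      pseudoFreeMk M' g ((a.app (op A)).hom m) := by
  classical
  change DirectSum.lmap (fun A => LinearMap.rTensor ({g : X ⟶ ι.obj A // D g} →₀ K)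
      (a.app (op A)).hom)
    (DirectSum.lof K C (fun A => M.obj (op A) ⊗[K] ({g : X ⟶ ι.obj A // D g} →₀ K)) A
      (m ⊗ₜ Finsupp.single g 1)) = _
  rw [DirectSum.lmap_lof, LinearMap.rTensor_tmul]
  rfl

lemma pseudoFree_hom_ext {X : B} {V : Type*} [AddCommGroup V] [Module K V]
    {a b : PseudoFreeObj ι D M X →ₗ[K] V}
    (h : ∀ (A : C) (g : {g : X ⟶ ι.obj A // D g}) (m : M.obj (op A)),
      a (pseudoFreeMk M g m) = b (pseudoFreeMk M g m)) : a = b :=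
  pseudoFree_ext fun A m g => h A g m

lemma IsCrossed.id_mem (h : IsCrossed ι D) (X : B) : D (𝟙 X) :=
  have := h.multiplicative
  D.id_mem X

variable (h : IsCrossed ι D) (M) (N : B ⥤ ModuleCat.{u} K)

variable (ι D) in
/-- The bilinear map `(m ⊗ g, n) ↦ m ⊗ N(g) n`. -/
noncomputable def pseudoFreePairing (X : B) :
    PseudoFreeObj ι D M X →ₗ[K] N.obj X →ₗ[K] (tensor.obj M).obj (ι ⋙ N) :=
  pseudoFreeDesc fun A g => (tensorMk M (ι ⋙ N) A).compl₂ (N.map g.1).hom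

lemma pseudoFreePairing_mk {X : B} {A : C} (g : {g : X ⟶ ι.obj A // D g})
    (m : M.obj (op A)) (n : N.obj X) :
    pseudoFreePairing ι D M N X (pseudoFreeMk M g m) n =
      tensorMk M (ι ⋙ N) A m ((N.map g.1).hom n) := by
  rw [pseudoFreePairing, pseudoFreeDesc_mk]
  rfl

/-- If g ∘ Φ = Ψ ∘ f, the left side at m ⊗ g is mΨ ⊗ N(f)n. The relation over C moves Ψ across the
tensor sign and leaves m ⊗ N(Ψ ∘ f)n = m ⊗ N(g)N(Φ)n. -/
lemma IsCrossed.pseudoFreePairing_map {X Y : B} (Φ : X ⟶ Y)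
    (m : ((h.pseudoFree K).obj M).obj (op Y)) (n : N.obj X) :
    pseudoFreePairing ι D M N X ((((h.pseudoFree K).obj M).map Φ.op).hom m) n =
      pseudoFreePairing ι D M N Y m ((N.map Φ).hom n) := by
  refine LinearMap.congr_fun (f := (pseudoFreePairing ι D M N X).flip n ∘ₗ
      (((h.pseudoFree K).obj M).map Φ.op).hom)
    (g := (pseudoFreePairing ι D M N Y).flip ((N.map Φ).hom n)) ?_ m
  refine pseudoFree_hom_ext fun A g m => ?_
  change pseudoFreePairing ι D M N X
    ((((h.pseudoFree K).obj M).map Φ.op).hom (pseudoFreeMk M g m)) n =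
      pseudoFreePairing ι D M N Y (pseudoFreeMk M g m) ((N.map Φ).hom n)
  rw [pseudoFree_map_mk, pseudoFreePairing_mk, pseudoFreePairing_mk, tensorMk_map]
  congr 1
  have e := congrArg (fun t => (N.map t).hom n) (h.factor_spec (Φ ≫ g.1))
  simpa using e

/-- The map `L_D(M) ⊗_B N → M ⊗_C O(N)`, `(m ⊗ g) ⊗ n ↦ m ⊗ N(g) n`. -/
noncomputable def IsCrossed.tensorHom :
    ((tensor.obj ((h.pseudoFree K).obj M)).obj N : Type u) →ₗ[K]
      (tensor.obj M).obj (ι ⋙ N) :=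
  tensorDesc (M := (h.pseudoFree K).obj M) (fun X => pseudoFreePairing ι D M N X)
    (h.pseudoFreePairing_map M N)

lemma IsCrossed.tensorHom_mk {X : B} {A : C} (g : {g : X ⟶ ι.obj A // D g})
    (m : M.obj (op A)) (n : N.obj X) :
    h.tensorHom M N (tensorMk ((h.pseudoFree K).obj M) N X (pseudoFreeMk M g m) n) =
      tensorMk M (ι ⋙ N) A m ((N.map g.1).hom n) :=
  (tensorDesc_mk _ (h.pseudoFreePairing_map M N) _ _ _).trans (pseudoFreePairing_mk M N g m n)

/-- The bilinear map `(m, n) ↦ (m ⊗ id) ⊗ n`. -/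
noncomputable def IsCrossed.unitPairing (A : C) :
    M.obj (op A) →ₗ[K] N.obj (ι.obj A) →ₗ[K] (tensor.obj ((h.pseudoFree K).obj M)).obj N :=
  (tensorMk ((h.pseudoFree K).obj M) N (ι.obj A)).comp
    (pseudoFreeMk M ⟨𝟙 (ι.obj A), h.id_mem _⟩)

lemma IsCrossed.unitPairing_map {X Y : C} (Ψ : X ⟶ Y) (m : M.obj (op Y))
    (n : N.obj (ι.obj X)) :
    h.unitPairing M N X ((M.map Ψ.op).hom m) n =
      h.unitPairing M N Y m ((N.map (ι.map Ψ)).hom n) := by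
  refine Eq.trans ?_ (tensorMk_map (M := (h.pseudoFree K).obj M) (ι.map Ψ) _ n)
  exact congrArg (fun t => tensorMk ((h.pseudoFree K).obj M) N (ι.obj X) t n)
    (pseudoFree_map_mk_of_eq h (ι.map Ψ) ⟨𝟙 (ι.obj Y), h.id_mem _⟩ m
      ⟨𝟙 (ι.obj X), h.id_mem _⟩ Ψ (by simp)).symm

/-- The map `M ⊗_C O(N) → L_D(M) ⊗_B N`, `m ⊗ n ↦ (m ⊗ id) ⊗ n`. -/
noncomputable def IsCrossed.tensorInv :
    ((tensor.obj M).obj (ι ⋙ N) : Type u) →ₗ[K]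
      (tensor.obj ((h.pseudoFree K).obj M)).obj N :=
  tensorDesc (M := M) (N := ι ⋙ N) (h.unitPairing M N) (h.unitPairing_map M N)

lemma IsCrossed.tensorInv_mk {A : C} (m : M.obj (op A)) (n : N.obj (ι.obj A)) :
    h.tensorInv M N (tensorMk M (ι ⋙ N) A m n) =
      tensorMk ((h.pseudoFree K).obj M) N (ι.obj A)
        (pseudoFreeMk M ⟨𝟙 (ι.obj A), h.id_mem _⟩ m) n :=
  tensorDesc_mk (N := ι ⋙ N) _ (h.unitPairing_map M N) _ _ _

variable {M N} in
lemma IsCrossed.tensor_pseudoFree_hom_ext {V : Type*} [AddCommGroup V] [Module K V]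
    {a b : ((tensor.obj ((h.pseudoFree K).obj M)).obj N : Type u) →ₗ[K] V}
    (hab : ∀ (X : B) (A : C) (g : {g : X ⟶ ι.obj A // D g}) (m : M.obj (op A)) (n : N.obj X),
      a (tensorMk ((h.pseudoFree K).obj M) N X (pseudoFreeMk M g m) n) =
        b (tensorMk ((h.pseudoFree K).obj M) N X (pseudoFreeMk M g m) n)) : a = b :=
  tensor_hom_ext fun X m n => LinearMap.congr_fun
    (f := a ∘ₗ (tensorMk ((h.pseudoFree K).obj M) N X).flip n)
    (g := b ∘ₗ (tensorMk ((h.pseudoFree K).obj M) N X).flip n)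
    (pseudoFree_hom_ext fun A g m => hab X A g m n) m

/-- The isomorphism `L_D(M) ⊗_B N ≃ M ⊗_C O(N)`. -/
noncomputable def IsCrossed.tensorEquiv :
    ((tensor.obj ((h.pseudoFree K).obj M)).obj N : Type u) ≃ₗ[K]
      (tensor.obj M).obj (ι ⋙ N) :=
  LinearEquiv.ofLinearMap (h.tensorHom M N) (h.tensorInv M N)
    (tensor_hom_ext fun A m n => by
      rw [LinearMap.comp_apply, h.tensorInv_mk, h.tensorHom_mk]
      simp)
    (h.tensor_pseudoFree_hom_ext fun X A g m n => by
      rw [LinearMap.comp_apply, h.tensorHom_mk, h.tensorInv_mk]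
      -- The relation over B moves g back to the left factor. There (m ⊗ id)g = m ⊗ g, because id ∘
      -- g has the factorization with trivial C-part.
      refine (tensorMk_map (M := (h.pseudoFree K).obj M) g.1 _ n).symm.trans ?_
      refine congrArg (fun t => tensorMk ((h.pseudoFree K).obj M) N X t n)
        ((pseudoFree_map_mk_of_eq h g.1 _ m g (𝟙 A) (by simp)).trans ?_)
      exact congrArg (pseudoFreeMk M g) (by simp))

variable {N} in
lemma IsCrossed.tensorHom_naturality_right {N' : B ⥤ ModuleCat.{u} K} (b : N ⟶ N') :
    h.tensorHom M N' ∘ₗ ((tensor.obj ((h.pseudoFree K).obj M)).map b).hom =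
      ((tensor.obj M).map (Functor.whiskerLeft ι b)).hom ∘ₗ h.tensorHom M N := by
  refine h.tensor_pseudoFree_hom_ext fun X A g m n => ?_
  refine (congrArg (h.tensorHom M N') (tensor_obj_map_mk b X _ n)).trans
    ((h.tensorHom_mk M N' g m _).trans ?_)
  refine Eq.trans ?_ ((congrArg ((tensor.obj M).map (Functor.whiskerLeft ι b)).hom
    (h.tensorHom_mk M N g m n)).trans (tensor_obj_map_mk _ _ _ _)).symm
  exact congrArg (tensorMk M (ι ⋙ N') A m)
    (congrArg (fun t => t.hom n) (b.naturality g.1)).symm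

variable {M} in
lemma IsCrossed.tensorHom_naturality_left (a : M ⟶ M') :
    h.tensorHom M' N ∘ₗ ((tensor.map ((h.pseudoFree K).map a)).app N).hom =
      ((tensor.map a).app (ι ⋙ N)).hom ∘ₗ h.tensorHom M N := by
  refine h.tensor_pseudoFree_hom_ext fun X A g m n => ?_
  refine (congrArg (h.tensorHom M' N) ((tensor_map_app_mk _ X _ n).trans
    (congrArg (fun t => tensorMk ((h.pseudoFree K).obj M') N X t n)
      (pseudoFree_map_app_mk h a g m)))).trans ((h.tensorHom_mk M' N g _ n).trans ?_)
  exact ((congrArg ((tensor.map a).app (ι ⋙ N)).hom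
    (h.tensorHom_mk M N g m n)).trans (tensor_map_app_mk _ _ _ _)).symm

variable (K)

/-- The pseudo-adjunction between `L_D` and `O`. -/
noncomputable def IsCrossed.pseudoAdjunction :
    h.pseudoFree K ⋙ tensor ≅
      tensor ⋙ (Functor.whiskeringLeft _ _ _).obj (forgetTo K ι) :=
  NatIso.ofComponents
    (fun M => NatIso.ofComponents (fun N => (h.tensorEquiv M N).toModuleIso)
      fun b => ModuleCat.hom_ext (h.tensorHom_naturality_right M b))
    fun a => by
      ext N : 2
      exact ModuleCat.hom_ext (h.tensorHom_naturality_left N a)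

end PseudoFree

/-! ### Restriction preserves projectives; derived functors of the composite -/

section Restriction

variable {K : Type u} [CommRing K] {B C : Type} [SmallCategory B] [SmallCategory C]
  {ι : C ⥤ B} {D : MorphismProperty B}

/-- Every projective module is a retract of a coproduct of modules `K[Hom(X, -)]`. -/
lemma exists_retract_sigma_linCorep (P : B ⥤ ModuleCat.{u} K) [Projective P] :
    Nonempty (Retract P (∐ fun s : Σ X : B, P.obj X => linCorep K s.1)) := by
  let F : (Σ X : B, P.obj X) → (B ⥤ ModuleCat.{u} K) := fun s => linCorep K s.1
  let p : ∐ F ⟶ P := Limits.Sigma.desc fun s => linCorepDesc P s.2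
  have : Epi p := by
    rw [NatTrans.epi_iff_epi_app]
    intro Y
    rw [ModuleCat.epi_iff_surjective]
    intro n
    refine ⟨((Limits.Sigma.ι F ⟨Y, n⟩).app Y).hom (Finsupp.single (𝟙 Y) (1 : K)), ?_⟩
    have := congrArg (fun t => (t.app Y).hom (Finsupp.single (𝟙 Y) (1 : K)))
      (Limits.Sigma.ι_desc (f := F) (fun s => linCorepDesc P s.2) ⟨Y, n⟩)
    exact this.trans (linCorepDesc_id P n)
  exact ⟨⟨Projective.factorThru (𝟙 P) p, p, Projective.factorThru_comp _ _⟩⟩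

/-- The restriction of `K[Hom_B(X, -)]` to `C` is the coproduct of the `K[Hom_C(Y, -)]` over all
morphisms `X ⟶ Y` of `D`. -/
lemma IsCrossed.projective_restrict_linCorep (h : IsCrossed ι D) (X : B) :
    Projective (ι ⋙ linCorep K X) := by
  constructor
  intro E N f e he
  have hs : ∀ Y : C, Function.Surjective (e.app Y).hom := fun Y =>
    (ModuleCat.epi_iff_surjective _).1 inferInstance
  choose s hs using hs
  -- The D-parts are free generators over C: preimages are chosen only for them, and the value at a
  -- general `Φ` is transported along its C-part.
  let lift : ∀ Y : C, (X ⟶ ι.obj Y) → E.obj Y := fun Y Φ =>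
    (E.map (h.factor Φ).2.1).hom
      (s _ ((f.app _).hom (Finsupp.single (h.factor Φ).2.2.1 (1 : K))))
  refine ⟨{ app := fun Y => ModuleCat.ofHom (Finsupp.linearCombination K (lift Y))
            naturality := ?_ }, ?_⟩
  · intro Y Y' Ψ
    refine ModuleCat.hom_ext (Finsupp.lhom_ext' fun Φ => LinearMap.ext_ring ?_)
    change Finsupp.linearCombination K (lift Y')
        (Finsupp.mapDomain (fun g => g ≫ ι.map Ψ) (Finsupp.single Φ (1 : K))) =
      (E.map Ψ).hom (Finsupp.linearCombination K (lift Y) (Finsupp.single Φ (1 : K)))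
    rw [Finsupp.mapDomain_single, Finsupp.linearCombination_single,
      Finsupp.linearCombination_single, one_smul, one_smul]
    -- Composing with a morphism of C leaves the D-part unchanged, which is exactly the naturality
    -- of the lift.
    have e : h.factor (Φ ≫ ι.map Ψ) = ⟨_, (h.factor Φ).2.1 ≫ Ψ, (h.factor Φ).2.2⟩ :=
      h.factor_eq _ _ (by rw [Functor.map_comp, ← Category.assoc, h.factor_spec])
    simp only [lift]
    rw [e]
    simp
  · ext Y : 2
    refine ModuleCat.hom_ext (Finsupp.lhom_ext' fun Φ => LinearMap.ext_ring ?_)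
    change (e.app Y).hom (Finsupp.linearCombination K (lift Y) (Finsupp.single Φ (1 : K))) =
      (f.app Y).hom (Finsupp.single Φ (1 : K))
    rw [Finsupp.linearCombination_single, one_smul]
    have h1 := congrArg (fun t => t.hom (s _ ((f.app _).hom
      (Finsupp.single (h.factor Φ).2.2.1 (1 : K))))) (e.naturality (h.factor Φ).2.1)
    refine h1.trans ?_
    have h2 := congrArg (fun t => t.hom (Finsupp.single (h.factor Φ).2.2.1 (1 : K)))
      (f.naturality (h.factor Φ).2.1)
    refine (congrArg (N.map (h.factor Φ).2.1).hom (hs _ _)).trans (h2.symm.trans ?_)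
    refine congrArg (f.app Y).hom ?_
    refine Finsupp.mapDomain_single.trans ?_
    rw [h.factor_spec]

/-- Restriction preserves coproducts and retracts, so the case of the modules K[Hom(X, -)] suffices.
-/
lemma IsCrossed.preservesProjectiveObjects_forgetTo (h : IsCrossed ι D) :
    (forgetTo K ι).PreservesProjectiveObjects where
  projective_obj {P} hP := by
    let F : (Σ X : B, P.obj X) → (B ⥤ ModuleCat.{u} K) := fun s => linCorep K s.1
    have : ∀ s, Projective ((forgetTo K ι).obj (F s)) :=
      fun s => h.projective_restrict_linCorep s.1
    have : Projective ((forgetTo K ι).obj (∐ F)) :=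
      Projective.of_iso (Limits.PreservesCoproduct.iso (forgetTo K ι) F).symm inferInstance
    obtain ⟨r⟩ := exists_retract_sigma_linCorep P
    exact (r.map (forgetTo K ι)).projective

instance : (forgetTo K ι).Additive where

end Restriction

/-- Left derived functors of a composite with an exact functor that preserves projectives. -/
noncomputable def leftDerivedCompIso {A A' E : Type*} [Category* A] [Category* A'] [Category* E]
    [Abelian A] [Abelian A'] [Abelian E] [HasProjectiveResolutions A]
    [HasProjectiveResolutions A'] (R : A ⥤ A') [R.Additive] [R.PreservesProjectiveObjects]
    [R.PreservesHomology] (F : A' ⥤ E) [F.Additive] (n : ℕ) :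
    (R ⋙ F).leftDerived n ≅ R ⋙ F.leftDerived n :=
  NatIso.ofComponents
    (fun Z => (projectiveResolution Z).isoLeftDerivedObj (R ⋙ F) n ≪≫
      ((R.mapProjectiveResolution (projectiveResolution Z)).isoLeftDerivedObj F n).symm)
    (by
      intro Z Z' f
      have e0 := ProjectiveResolution.lift_commutes_zero f (projectiveResolution Z)
        (projectiveResolution Z')
      have e1 := ProjectiveResolution.isoLeftDerivedObj_hom_naturality f (projectiveResolution Z)
        (projectiveResolution Z') (ProjectiveResolution.lift f _ _) e0 (R ⋙ F) n
      -- The image under `R` of a lift of `f` is a lift of `R.map f` to the image resolutions, so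
      -- one chain map computes both induced maps.
      have e2 := ProjectiveResolution.isoLeftDerivedObj_inv_naturality (R.map f)
        (R.mapProjectiveResolution (projectiveResolution Z))
        (R.mapProjectiveResolution (projectiveResolution Z'))
        ((R.mapHomologicalComplex _).map (ProjectiveResolution.lift f _ _)) (by
          have e3 := (R.map_comp _ _).symm.trans ((congrArg R.map e0).trans (R.map_comp _ _))
          refine (congrArg (_ ≫ ·) ?_).trans (e3.trans (congrArg (· ≫ R.map f) ?_).symm)
          -- In degree 0, the augmentation of an image resolution is the image of the augmentation,
          -- up to comparison maps that are identities.
          all_goals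
            simp only [Functor.mapProjectiveResolution_π, HomologicalComplex.comp_f,
              HomologicalComplex.singleMapHomologicalComplex_hom_app_self]
            exact (congrArg (_ ≫ ·) ((Category.comp_id _).trans (R.map_id _))).trans
              (Category.comp_id _)) F n
      change ((R ⋙ F).leftDerived n).map f ≫
          ((projectiveResolution Z').isoLeftDerivedObj (R ⋙ F) n).hom ≫
            ((R.mapProjectiveResolution (projectiveResolution Z')).isoLeftDerivedObj F n).inv =
        (((projectiveResolution Z).isoLeftDerivedObj (R ⋙ F) n).hom ≫
          ((R.mapProjectiveResolution (projectiveResolution Z)).isoLeftDerivedObj F n).inv) ≫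
            (F.leftDerived n).map (R.map f)
      refine (Category.assoc _ _ _).symm.trans ((congrArg (· ≫ _) e1).trans ?_)
      refine Eq.trans ?_ ((Category.assoc _ _ _).trans (congrArg (_ ≫ ·) e2)).symm
      exact Category.assoc _ _ _)

/-! ### When a cokernel of representables is L_D(K) -/

section Cokernel

variable {B C : Type} [SmallCategory B] [SmallCategory C] {ι : C ⥤ B} {D : MorphismProperty B}

/-- The part of the factorization of a morphism that lies in `D`. -/
noncomputable def IsCrossed.leg (h : IsCrossed ι D) {X : B} {Z : C} (Φ : X ⟶ ι.obj Z) :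
    Σ A : C, {g : X ⟶ ι.obj A // D g} :=
  ⟨(h.factor Φ).1, (h.factor Φ).2.2⟩

lemma IsCrossed.leg_comp (h : IsCrossed ι D) {X : B} {A Z : C} (g : {g : X ⟶ ι.obj A // D g})
    (Ψ : A ⟶ Z) : h.leg (g.1 ≫ ι.map Ψ) = ⟨A, g⟩ := by
  rw [IsCrossed.leg, h.factor_eq (g.1 ≫ ι.map Ψ) ⟨A, Ψ, g⟩ rfl]

variable (K : Type u) [CommRing K]

/-- The basis elements of `L_D(K)`. -/
noncomputable def trivialPseudoFreeBasis {X : B} (s : Σ A : C, {g : X ⟶ ι.obj A // D g}) :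
    PseudoFreeObj ι D (trivialModule K Cᵒᵖ) X :=
  pseudoFreeMk (trivialModule K Cᵒᵖ) s.2 (1 : K)

lemma trivialPseudoFree_hom_ext {X : B} {V : Type*} [AddCommGroup V] [Module K V]
    {a b : PseudoFreeObj ι D (trivialModule K Cᵒᵖ) X →ₗ[K] V}
    (h : ∀ s : Σ A : C, {g : X ⟶ ι.obj A // D g},
      a (trivialPseudoFreeBasis K s) = b (trivialPseudoFreeBasis K s)) : a = b := by
  refine pseudoFree_hom_ext fun A g m => ?_
  exact LinearMap.congr_fun (LinearMap.ext_ring (f := a ∘ₗ pseudoFreeMk (trivialModule K Cᵒᵖ) g)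
    (g := b ∘ₗ pseudoFreeMk (trivialModule K Cᵒᵖ) g) (h ⟨A, g⟩)) m

/-- C-parts act as the identity on the trivial module, so only D-parts are seen, and the D-part of Ψ
∘ Φ depends on Ψ only through the D-part of Ψ. -/
lemma IsCrossed.map_trivialPseudoFreeBasis (h : IsCrossed ι D) {X Y : B} {Z : C} (Φ : X ⟶ Y)
    (Ψ : Y ⟶ ι.obj Z) :
    (((h.pseudoFree K).obj (trivialModule K Cᵒᵖ)).map Φ.op).hom
      (trivialPseudoFreeBasis K (h.leg Ψ)) = trivialPseudoFreeBasis K (h.leg (Φ ≫ Ψ)) := by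
  have e : h.leg (Φ ≫ Ψ) = h.leg (Φ ≫ (h.factor Ψ).2.2.1) := by
    have e' : Φ ≫ Ψ = (h.factor (Φ ≫ (h.factor Ψ).2.2.1)).2.2.1 ≫
        ι.map ((h.factor (Φ ≫ (h.factor Ψ).2.2.1)).2.1 ≫ (h.factor Ψ).2.1) := by
      rw [Functor.map_comp, ← Category.assoc, h.factor_spec, Category.assoc, h.factor_spec]
    rw [e']
    exact h.leg_comp (h.factor (Φ ≫ (h.factor Ψ).2.2.1)).2.2 _
  rw [e]
  exact pseudoFree_map_mk h Φ (h.leg Ψ).2 _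

/-- The morphism `K[Hom(-, Z)] ⟶ L_D(K)`. -/
noncomputable def IsCrossed.fromLinRep (h : IsCrossed ι D) (Z : C) :
    linRep K (ι.obj Z) ⟶ (h.pseudoFree K).obj (trivialModule K Cᵒᵖ) where
  app X := ModuleCat.ofHom (Finsupp.linearCombination K
    fun Φ : X.unop ⟶ ι.obj Z => trivialPseudoFreeBasis K (h.leg Φ))
  naturality X Y Φ := by
    refine ModuleCat.hom_ext (Finsupp.lhom_ext' fun Ψ => LinearMap.ext_ring ?_)
    change Finsupp.linearCombination K
        (fun Φ : Y.unop ⟶ ι.obj Z => trivialPseudoFreeBasis K (h.leg Φ))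
        (Finsupp.mapDomain (fun g => Φ.unop ≫ g) (Finsupp.single Ψ (1 : K))) =
      (((h.pseudoFree K).obj (trivialModule K Cᵒᵖ)).map Φ).hom (Finsupp.linearCombination K
        (fun Φ : X.unop ⟶ ι.obj Z => trivialPseudoFreeBasis K (h.leg Φ))
        (Finsupp.single Ψ (1 : K)))
    rw [Finsupp.mapDomain_single, Finsupp.linearCombination_single,
      Finsupp.linearCombination_single, one_smul, one_smul]
    exact (h.map_trivialPseudoFreeBasis K Φ.unop Ψ).symm

lemma IsCrossed.fromLinRep_app_single (h : IsCrossed ι D) (Z : C) {X : B} (Φ : X ⟶ ι.obj Z) :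
    ((h.fromLinRep K Z).app (op X)).hom (Finsupp.single Φ (1 : K)) =
      trivialPseudoFreeBasis K (h.leg Φ) := by
  change Finsupp.linearCombination K
    (fun Φ : X ⟶ ι.obj Z => trivialPseudoFreeBasis K (h.leg Φ)) (Finsupp.single Φ (1 : K)) = _
  rw [Finsupp.linearCombination_single, one_smul]

lemma linRepMap_sub_app_single {W Z X : B} (d₀ d₁ : W ⟶ Z) (Φ : X ⟶ W) :
    ((linRepMap K d₀ - linRepMap K d₁).app (op X)).hom (Finsupp.single Φ (1 : K)) =
      (Finsupp.single (Φ ≫ d₀) 1 - Finsupp.single (Φ ≫ d₁) 1 : (X ⟶ Z) →₀ K) := by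
  change Finsupp.mapDomain (fun g => g ≫ d₀) (Finsupp.single Φ (1 : K)) -
    Finsupp.mapDomain (fun g => g ≫ d₁) (Finsupp.single Φ (1 : K)) = _
  rw [Finsupp.mapDomain_single, Finsupp.mapDomain_single]

/-- A criterion for the cokernel of `Φ ↦ d₀ ∘ Φ - d₁ ∘ Φ` to be `L_D(K)`. -/
theorem IsCrossed.nonempty_cokernel_iso (h : IsCrossed ι D) {W : B} {Z : C}
    (d₀ d₁ : W ⟶ ι.obj Z) (hW : ∀ s t : Σ A : C, {g : W ⟶ ι.obj A // D g}, s = t)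
    (hZ : ∀ Y : C, Nonempty (Y ⟶ Z))
    (hd : ∀ Y : C, ∃ s : ι.obj Y ⟶ ι.obj Z, ∀ Ψ : Y ⟶ Z, ι.map Ψ = s ∨
      ∃ χ : ι.obj Y ⟶ W, s = χ ≫ d₀ ∧ ι.map Ψ = χ ≫ d₁) :
    Nonempty (Limits.cokernel (linRepMap K d₀ - linRepMap K d₁) ≅
      (h.pseudoFree K).obj (trivialModule K Cᵒᵖ)) := by
  let δ := linRepMap K d₀ - linRepMap K d₁
  have hα : δ ≫ h.fromLinRep K Z = 0 := by
    ext X : 2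
    refine ModuleCat.hom_ext (Finsupp.lhom_ext' fun Φ => LinearMap.ext_ring ?_)
    change ((h.fromLinRep K Z).app X).hom ((δ.app X).hom (Finsupp.single Φ (1 : K))) = 0
    refine (congrArg _ (linRepMap_sub_app_single K d₀ d₁ Φ)).trans ?_
    refine (map_sub ((h.fromLinRep K Z).app X).hom _ _).trans ?_
    refine sub_eq_zero.2 ?_
    refine (h.fromLinRep_app_single K Z (Φ ≫ d₀)).trans
      (Eq.trans ?_ (h.fromLinRep_app_single K Z (Φ ≫ d₁)).symm)
    -- The two images come from the D-parts of `d₀` and `d₁` by the action of `Φ`, and `hW` leaves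
    -- only one possible D-part.
    rw [← h.map_trivialPseudoFreeBasis K, ← h.map_trivialPseudoFreeBasis K,
      hW (h.leg d₀) (h.leg d₁)]
  let π := Limits.cokernel.π δ
  let cls : ∀ {X : B}, (X ⟶ ι.obj Z) → (Limits.cokernel δ).obj (op X) := fun {X} Φ =>
    (π.app (op X)).hom (Finsupp.single Φ (1 : K))
  have hcls : ∀ {X : B} (Φ : X ⟶ W), cls (Φ ≫ d₀) = cls (Φ ≫ d₁) := by
    intro X Φ
    have e := congrArg (fun t => (t.app (op X)).hom (Finsupp.single Φ (1 : K)))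
      (Limits.cokernel.condition δ)
    have e' := (congrArg (π.app (op X)).hom (linRepMap_sub_app_single K d₀ d₁ Φ)).symm.trans e
    exact sub_eq_zero.1 ((map_sub (π.app (op X)).hom _ _).symm.trans e')
  -- A class in the cokernel depends only on the D-part of its representative: by `hd`, each C-part
  -- can be replaced by the reference morphism `s`.
  have hcls' : ∀ {X : B} {A : C} (g : X ⟶ ι.obj A) (Ψ Ψ' : A ⟶ Z),
      cls (g ≫ ι.map Ψ) = cls (g ≫ ι.map Ψ') := by
    intro X A g Ψ Ψ'
    obtain ⟨s, hs⟩ := hd A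
    have key : ∀ Ψ : A ⟶ Z, cls (g ≫ ι.map Ψ) = cls (g ≫ s) := by
      intro Ψ
      rcases hs Ψ with e | ⟨χ, e, e'⟩
      · rw [e]
      · rw [e, e', ← Category.assoc, ← Category.assoc, hcls]
    rw [key, key]
  let γ := Limits.cokernel.desc δ (h.fromLinRep K Z) hα
  have hγ : ∀ {X : B} (Φ : X ⟶ ι.obj Z), (γ.app (op X)).hom (cls Φ) =
      trivialPseudoFreeBasis K (h.leg Φ) := by
    intro X Φ
    have e := congrArg (fun t => (t.app (op X)).hom (Finsupp.single Φ (1 : K)))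
      (Limits.cokernel.π_desc δ (h.fromLinRep K Z) hα)
    exact e.trans (h.fromLinRep_app_single K Z Φ)
  -- The inverse completes a D-morphism by an arbitrary morphism of C to `Z`. Such a morphism exists
  -- by `hZ`, and its choice is immaterial by `hcls'`.
  let β : ∀ X : B, PseudoFreeObj ι D (trivialModule K Cᵒᵖ) X →ₗ[K]
      (Limits.cokernel δ).obj (op X) := fun X =>
    pseudoFreeDesc (M := trivialModule K Cᵒᵖ) fun A g =>
      LinearMap.toSpanSingleton K _ (cls (g.1 ≫ ι.map (hZ A).some))
  have hβ : ∀ {X : B} (s : Σ A : C, {g : X ⟶ ι.obj A // D g}),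
      β X (trivialPseudoFreeBasis K s) = cls (s.2.1 ≫ ι.map (hZ s.1).some) := by
    intro X s
    refine (pseudoFreeDesc_mk (M := trivialModule K Cᵒᵖ) _ s.2 (1 : K)).trans ?_
    exact one_smul K _
  have : ∀ X, IsIso (γ.app X) := by
    rintro ⟨X⟩
    refine ⟨ModuleCat.ofHom (β X), ?_, ?_⟩
    · rw [← cancel_epi (π.app (op X))]
      refine ModuleCat.hom_ext (Finsupp.lhom_ext' fun Φ => LinearMap.ext_ring ?_)
      change β X ((γ.app (op X)).hom (cls Φ)) = cls Φ
      rw [hγ, hβ]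
      conv_rhs => rw [← h.factor_spec Φ]
      exact hcls' _ _ _
    · refine ModuleCat.hom_ext (trivialPseudoFree_hom_ext K fun s => ?_)
      refine (congrArg (γ.app (op X)).hom (hβ s)).trans ((hγ _).trans ?_)
      rw [h.leg_comp]
      rfl
  have : IsIso γ := NatIso.isIso_of_isIso_app γ
  exact ⟨asIso γ⟩

end Cokernel

/-! ### Total orders on [n] as morphisms to [0], and their rotations -/

section OrdersOnOneFibre

/-- The morphism `[n] ⟶ [0]` of `F(as)` given by the standard order. -/
def FAs.standard (n : ℕ) : (⟨n⟩ : FAs) ⟶ ⟨0⟩ :=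
  FAs.Hom.mk (X := ⟨n⟩) (Y := ⟨0⟩) (fun _ => 0) (fun x y => x ≤ y) (fun _ => rfl) le_refl
    le_trans le_antisymm (fun {x y} _ => le_total x y)

/-- The nondecreasing map `[n] ⟶ [1]` that sends the elements below `a` to `0` and the others
to `1`, with the standard order on the fibres. -/
def FAs.cut {n : ℕ} (a : Fin (n + 1)) : (⟨n⟩ : FAs) ⟶ ⟨1⟩ :=
  FAs.Hom.mk (X := ⟨n⟩) (Y := ⟨1⟩) (fun x => if x < a then 0 else 1)
    (fun x y => (x < a ↔ y < a) ∧ x ≤ y) (fun h => by simp only [h.1])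
    (fun x => ⟨Iff.rfl, le_rfl⟩) (fun h h' => ⟨h.1.trans h'.1, h.2.trans h'.2⟩)
    (fun h h' => le_antisymm h.2 h'.2) (by
      intro x y h
      have : x < a ↔ y < a := by
        by_cases hx : x < a <;> by_cases hy : y < a
        · exact iff_of_true hx hy
        · simp [hx, hy] at h
        · simp [hx, hy] at h
        · exact iff_of_false hx hy
      exact (le_total x y).imp (fun h => ⟨this, h⟩) fun h => ⟨this.symm, h⟩)

lemma FAs.cut_toFun {n : ℕ} (a x : Fin (n + 1)) :
    (FAs.cut a).toFun x = if x < a then (0 : Fin 2) else 1 := rfl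

lemma FAs.cut_toFun_le {n : ℕ} (a x y : Fin (n + 1)) :
    ((FAs.cut a).toFun x : Fin 2) ≤ (FAs.cut a).toFun y ↔ (y < a → x < a) := by
  rw [FAs.cut_toFun, FAs.cut_toFun]
  by_cases hx : x < a <;> by_cases hy : y < a <;> simp [hx, hy]

/-- The blocks below and above the cut are concatenated in their natural order. With `FAs.d1` in
place of `FAs.d0` they are interchanged, and the result is the rotation that begins at `a`. -/
lemma FAs.cut_comp_d0 {n : ℕ} (a : Fin (n + 1)) : FAs.cut a ≫ FAs.d0 = FAs.standard n := by
  refine FAs.ext_fibreLE (fun x => rfl) fun x y => ?_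
  change (((FAs.cut a).toFun x : Fin 2) ≤ (FAs.cut a).toFun y ∧
    ((FAs.cut a).toFun x = (FAs.cut a).toFun y → (x < a ↔ y < a) ∧ x ≤ y)) ↔ x ≤ y
  rw [le_antisymm_iff, FAs.cut_toFun_le, FAs.cut_toFun_le]
  constructor
  · rintro ⟨h1, h2⟩
    by_cases hx : x < a
    · by_cases hy : y < a
      · exact (h2 ⟨fun _ => hx, fun _ => hy⟩).2
      · exact hx.le.trans (not_lt.1 hy)
    · exact (h2 ⟨h1, fun h => absurd h hx⟩).2
  · exact fun h => ⟨fun h' => h.trans_lt h', fun h' => ⟨⟨h'.2, h'.1⟩, h⟩⟩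

/-- The shift sends z to z - a if z ≥ a and to z - a + n + 1 if z < a. So the block from `a` on
comes first, the block below `a` comes last, and each keeps its order. -/
lemma residueShift_neg_le_iff {n : ℕ} (a x y : Fin (n + 1)) :
    residueShift n (-(a : ℕ)) x ≤ residueShift n (-(a : ℕ)) y ↔
      (x < a → y < a) ∧ ((x < a ↔ y < a) → x ≤ y) := by
  have key : ∀ z : Fin (n + 1), ((residueShift n (-(a : ℕ)) z : ℕ) : ℤ) =
      if z < a then (z : ℤ) - (a : ℕ) + (n + 1) else (z : ℤ) - (a : ℕ) := by
    intro z
    rw [residueShift_apply, residue_coe]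
    split_ifs with hz
    · rw [Fin.lt_def] at hz
      rw [← Int.add_emod_right, Int.emod_eq_of_lt (by omega) (by omega)]
      ring
    · rw [Fin.lt_def] at hz
      rw [Int.emod_eq_of_lt (by omega) (by omega)]
      ring
  have hx := key x
  have hy := key y
  simp only [Fin.le_def, Fin.lt_def] at *
  split_ifs at hx hy <;> omega

/-- The target has one element, so the morphism is just an order, namely the rotation of the
standard one that begins at the residue a of `φ.adj.toFun 0`. If a = 0 it is standard; otherwise it
arises by interchanging the two blocks cut at a. In that case 0 < a, so the cut fixes 0 and serves
for Γ(as) as well. -/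
lemma PeriodicMap.toFAs_eq_standard_or {n : ℕ} (φ : PeriodicMap n 0) :
    φ.toFAs = FAs.standard n ∨ ∃ χ : (⟨n⟩ : FAs) ⟶ ⟨1⟩, FAs.pointed χ ∧
      FAs.standard n = χ ≫ FAs.d0 ∧ φ.toFAs = χ ≫ FAs.d1 := by
  obtain ⟨c, hc⟩ := exists_eq_residue_add n (φ.adj.toFun 0)
  have hfib : ∀ x y, φ.toFAs.fibreLE x y ↔
      (x < residue n (φ.adj.toFun 0) → y < residue n (φ.adj.toFun 0)) ∧
        ((x < residue n (φ.adj.toFun 0) ↔ y < residue n (φ.adj.toFun 0)) → x ≤ y) := by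
    intro x y
    have hs : ∀ z, residueShift n (-φ.adj.toFun 0) z =
        residueShift n (-((residue n (φ.adj.toFun 0) : Fin (n + 1)) : ℕ)) z := fun z =>
      (residue_eq_iff _ _ _).2 ⟨c, by linarith⟩
    rw [FAs.fibreLE_iff, ← φ.lexLE_toFAs, hs, hs, residueShift_neg_le_iff]
    exact and_iff_right (Subsingleton.elim (α := Fin 1) _ _)
  by_cases ha : residue n (φ.adj.toFun 0) = 0
  · left
    refine FAs.ext_fibreLE (fun x => Subsingleton.elim (α := Fin 1) _ _) fun x y => ?_
    rw [hfib, ha]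
    change _ ↔ x ≤ y
    simp
  · right
    refine ⟨FAs.cut (residue n (φ.adj.toFun 0)), ?_, (FAs.cut_comp_d0 _).symm,
      FAs.ext_fibreLE (fun x => Subsingleton.elim (α := Fin 1) _ _) fun x y => ?_⟩
    · exact if_pos (Fin.pos_of_ne_zero ha)
    · rw [hfib]
      generalize residue n (φ.adj.toFun 0) = a
      change _ ↔ (((FAs.cut a).toFun y : Fin 2) ≤ (FAs.cut a).toFun x ∧
        ((FAs.cut a).toFun x = (FAs.cut a).toFun y → (x < a ↔ y < a) ∧ x ≤ y))
      rw [le_antisymm_iff, FAs.cut_toFun_le, FAs.cut_toFun_le]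
      tauto

/-- A permutation of two elements that fixes one of them fixes the other. This supplies the
hypothesis `hW` of `IsCrossed.nonempty_cokernel_iso`. -/
lemma FAs.sigma_unique_of_len_one {f f' : (⟨1⟩ : FAs) ⟶ ⟨1⟩} (hf : FAs.sigma f)
    (hf' : FAs.sigma f') : f = f' := by
  refine FAs.ext_of_injective hf.1.1 fun x => ?_
  have h0 : f.toFun 0 = 0 := hf.2
  have h0' : f'.toFun 0 = 0 := hf'.2
  have key : ∀ {g : (⟨1⟩ : FAs) ⟶ ⟨1⟩}, FAs.sigma g → g.toFun (1 : Fin 2) = (1 : Fin 2) := by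
    intro g hg
    have h1 : g.toFun (1 : Fin 2) ≠ (0 : Fin 2) := fun e =>
      absurd (hg.1.1 (e.trans hg.2.symm)) (by decide : (1 : Fin 2) ≠ 0)
    exact Fin.eq_one_of_ne_zero _ h1
  obtain rfl | rfl : x = (0 : Fin 2) ∨ x = (1 : Fin 2) := by
    revert x
    change ∀ x : Fin 2, x = 0 ∨ x = 1
    decide
  · exact h0.trans h0'.symm
  · exact (key hf).trans (key hf').symm

end OrdersOnOneFibre

/-! ### The modules b and b̄, and the comparison of Tor -/

theorem nonempty_b_iso (K : Type u) [CommRing K] :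
    Nonempty (b K ≅ (isCrossed_cyclicInclusion.pseudoFree K).obj
      (trivialModule K CyclicCatᵒᵖᵒᵖ)) := by
  refine isCrossed_cyclicInclusion.nonempty_cokernel_iso K (Z := op (⟨0⟩ : CyclicCat))
    FAs.d0 FAs.d1 ?_ ?_ ?_
  · rintro ⟨⟨⟨n⟩⟩, f, hf⟩ ⟨⟨⟨n'⟩⟩, f', hf'⟩
    obtain rfl : 1 = n := FAs.len_eq_of_bijective hf.1
    obtain rfl : 1 = n' := FAs.len_eq_of_bijective hf'.1
    obtain rfl : f = f' := FAs.sigma_unique_of_len_one hf hf'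
    rfl
  · rintro ⟨⟨n⟩⟩
    exact ⟨(simplexToCyclic.map
      (SimplexCategory.const (SimplexCategory.mk 0) (SimplexCategory.mk n) 0)).op⟩
  · rintro ⟨⟨n⟩⟩
    refine ⟨FAs.standard n, fun Ψ => ?_⟩
    obtain ⟨φ, hφ⟩ := exists_toFAs_eq Ψ
    rw [hφ]
    exact φ.toFAs_eq_standard_or.imp_right fun ⟨χ, _, h⟩ => ⟨χ, h⟩

theorem nonempty_bBar_iso (K : Type u) [CommRing K] :
    Nonempty (bBar K ≅ (isCrossed_simplicialInclusion.pseudoFree K).obj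
      (trivialModule K SimplexCategoryᵒᵖᵒᵖ)) := by
  refine isCrossed_simplicialInclusion.nonempty_cokernel_iso K (Z := op (SimplexCategory.mk 0))
    GammaAs.d0 GammaAs.d1 ?_ ?_ ?_
  · rintro ⟨⟨⟨n⟩⟩, f, hf⟩ ⟨⟨⟨n'⟩⟩, f', hf'⟩
    obtain rfl : 1 = n := FAs.len_eq_of_bijective hf
    obtain rfl : 1 = n' := FAs.len_eq_of_bijective hf'
    obtain rfl : f = f' := WideSubcategory.hom_ext _
      (FAs.sigma_unique_of_len_one ⟨hf, f.property⟩ ⟨hf', f'.property⟩)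
    rfl
  · rintro ⟨⟨n⟩⟩
    exact ⟨(SimplexCategory.const (SimplexCategory.mk 0) (SimplexCategory.mk n) 0).op⟩
  · rintro ⟨⟨n⟩⟩
    -- Every morphism to [0] fixes 0, so the standard order is available in Γ(as); the alternative
    -- is the cyclic one with a pointed cut.
    refine ⟨⟨FAs.standard n, rfl⟩, fun Ψ => ?_⟩
    obtain ⟨φ, hφ⟩ := exists_toFAs_eq (simplexToCyclic.op.map Ψ)
    refine φ.toFAs_eq_standard_or.imp (fun h => WideSubcategory.hom_ext _ (hφ.trans h)) ?_
    rintro ⟨χ, hχ, h1, h2⟩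
    exact ⟨⟨χ, hχ⟩, WideSubcategory.hom_ext _ h1, WideSubcategory.hom_ext _ (hφ.trans h2)⟩

/-- Isomorphic functors have isomorphic left derived functors. -/
noncomputable def leftDerivedMapIso {A E : Type*} [Category* A] [Category* E] [Abelian A]
    [Abelian E] [HasProjectiveResolutions A] {F G : A ⥤ E} [F.Additive] [G.Additive]
    (e : F ≅ G) (n : ℕ) : F.leftDerived n ≅ G.leftDerived n where
  hom := NatTrans.leftDerived e.hom n
  inv := NatTrans.leftDerived e.inv n
  hom_inv_id := by rw [← NatTrans.leftDerived_comp, e.hom_inv_id, NatTrans.leftDerived_id]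
  inv_hom_id := by rw [← NatTrans.leftDerived_comp, e.inv_hom_id, NatTrans.leftDerived_id]

/-- `Tor^B(L_D(M), -) ≅ Tor^C(M, O(-))` if `B` is crossed by `C` and `D`. -/
theorem IsCrossed.nonempty_functorTor_iso {K : Type u} [CommRing K] {B C : Type}
    [SmallCategory B] [SmallCategory C] {ι : C ⥤ B} {D : MorphismProperty B}
    (h : IsCrossed ι D) (M : Cᵒᵖ ⥤ ModuleCat.{u} K) (n : ℕ) :
    Nonempty ((functorTor K B n).obj ((h.pseudoFree K).obj M) ≅
      forgetTo K ι ⋙ (functorTor K C n).obj M) := by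
  have := h.preservesProjectiveObjects_forgetTo (K := K)
  -- For fixed `M` the pseudo-adjunction is an isomorphism of functors of N, so it passes to left
  -- derived functors; those of the composite are computed on restricted resolutions.
  let e : tensor.obj ((h.pseudoFree K).obj M) ≅ forgetTo K ι ⋙ tensor.obj M :=
    (h.pseudoAdjunction K).app M
  exact ⟨leftDerivedMapIso e n ≪≫ leftDerivedCompIso (forgetTo K ι) (tensor.obj M) n⟩

end FunctorTor
theorem mainTheorem7 (K : Type u) [CommRing K] :
    (∃ h : IsCrossed simplicialInclusion GammaAs.sigma,
      IsPseudoAdjoint (h.pseudoFree K) (forgetTo K simplicialInclusion) ∧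
      Nonempty (bBar K ≅ (h.pseudoFree K).obj (trivialModule K SimplexCategoryᵒᵖᵒᵖ)) ∧
      ∀ n : ℕ,
        Nonempty ((functorTor K GammaAs n).obj (bBar K) ≅
          (functorTor K GammaAs n).obj
            ((h.pseudoFree K).obj (trivialModule K SimplexCategoryᵒᵖᵒᵖ))) ∧
        Nonempty ((functorTor K GammaAs n).obj
            ((h.pseudoFree K).obj (trivialModule K SimplexCategoryᵒᵖᵒᵖ)) ≅
          forgetTo K simplicialInclusion ⋙
            (functorTor K SimplexCategoryᵒᵖ n).obj (trivialModule K SimplexCategoryᵒᵖᵒᵖ))) ∧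
    (∃ h : IsCrossed cyclicInclusion FAs.sigma,
      IsPseudoAdjoint (h.pseudoFree K) (forgetTo K cyclicInclusion) ∧
      Nonempty (b K ≅ (h.pseudoFree K).obj (trivialModule K CyclicCatᵒᵖᵒᵖ)) ∧
      ∀ n : ℕ,
        Nonempty ((functorTor K FAs n).obj (b K) ≅
          (functorTor K FAs n).obj ((h.pseudoFree K).obj (trivialModule K CyclicCatᵒᵖᵒᵖ))) ∧
        Nonempty ((functorTor K FAs n).obj
            ((h.pseudoFree K).obj (trivialModule K CyclicCatᵒᵖᵒᵖ)) ≅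
          forgetTo K cyclicInclusion ⋙
            (functorTor K CyclicCatᵒᵖ n).obj (trivialModule K CyclicCatᵒᵖᵒᵖ))) := by
  obtain ⟨eBar⟩ := nonempty_bBar_iso K
  obtain ⟨e⟩ := nonempty_b_iso K
  exact ⟨⟨isCrossed_simplicialInclusion, ⟨isCrossed_simplicialInclusion.pseudoAdjunction K⟩, ⟨eBar⟩,
      fun n => ⟨⟨(functorTor K GammaAs n).mapIso eBar⟩,
        isCrossed_simplicialInclusion.nonempty_functorTor_iso _ n⟩⟩,
    ⟨isCrossed_cyclicInclusion, ⟨isCrossed_cyclicInclusion.pseudoAdjunction K⟩, ⟨e⟩,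
      fun n => ⟨⟨(functorTor K FAs n).mapIso e⟩,
        isCrossed_cyclicInclusion.nonempty_functorTor_iso _ n⟩⟩⟩
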